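/- **Polynomial algorithm for DMI-clustering in constant dimension.** *Setting.* Let $A\in\mathbb R^{n\times d}$, whose $n$ rows are the data points, let $A^{+1}=[A\ \ \mathbf 1]\in\mathbb R^{n\times(d+1)}$ be $A$ with a column of ones appended, and let $k=\operatorname{rank}(A^{+1})$ (so $k\le d+1$). A *column choice* is a list $L$ of $k$ linearly independent columns of $A^{+1}$; let $\tilde A\in\mathbb R^{n\times k}$ be the matrix formed by these columns. The hard-assignment constraint set is $$\mathcal C=\Big\{C\in\{0,1\}^{n\times k}\;\Big|\;\sum_{c}C_{ic}=1\text{ for all }i\Big\}.$$ *DMI-clustering* of $A$ (under the hard constraint) is the task of outputting, for some column choice $L$, the data $(k,C^*,L,D^*)$, where $C^*\in\operatorname{argmax}_{C\in\mathcal C}\det(C^{\top}\tilde A)$, the matrix $C^{*\top}\tilde A$ is invertible, and $D^*=(C^{*\top}\tilde A)^{-1}$. For $M\in\mathbb R^{n\times k}$ let $\operatorname{idxmax}(M)$ be the set of all $C\in\mathcal C$ such that, for every row $i$, the entry $1$ of row $i$ of $C$ stands at a position of a largest entry of row $i$ of $M$. The *linear partitions* of $\tilde A$ are the sets $\operatorname{idxmax}(\tilde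 A D)$, $D\in\mathbb R^{k\times k}$. Running time is measured on a real RAM: programs with while-loops, branches and arrays of natural and of real numbers indexed by natural numbers, in which every addition and (truncated) subtraction of natural numbers, every $+,-,\times,\div$ on real numbers, every exact comparison, every array access, every assignment and every branch costs one step; program constants are natural or rational numbers, and there is no rounding. *Statement.* Fix the dimension $d\ge 0$. Then: 1. There are a single program and a polynomial $T$ (both depending only on $d$) such that for every $n\geq 0$ and every $A\in\mathbb R^{n\times d}$ the program, started on $(n,A)$, halts after at most $T(n)$ steps and outputs a correct result $(k,C^*,L,D^*)$ of DMI-clustering of $A$ under the hard-assignment constraint. 2. The number of distinct linear partitions is polynomial in $n$: there is a constant $K$ depending only on $d$ such that for every $n$, every $A\in\mathbb R^{n\times d}$ and every column choice, $\tilde A$ has at most $K\,n^{k(k-1)(k+1)}$ distinct linear partitions (with the convention $0^0=1$). -/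

import Mathlib

namespace DMI

/-! ## DMI-clustering -/

/-- The data matrix with a column of ones appended on the right, `A⁺¹ = [A 1]`. -/
def augment {n d : ℕ} (A : Matrix (Fin n) (Fin d) ℝ) : Matrix (Fin n) (Fin (d + 1)) ℝ :=
  Matrix.of fun i => Fin.snoc (α := fun _ => ℝ) (A i) 1

/-- The matrix `Ã` whose columns are the columns of `A⁺¹` listed by `L`. -/
def picked {n d k : ℕ} (A : Matrix (Fin n) (Fin d) ℝ) (L : Fin k → Fin (d + 1)) :
    Matrix (Fin n) (Fin k) ℝ :=
  (augment A).submatrix id L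

/-- `k` is the rank of `A⁺¹`, and `L` lists `k` linearly independent columns of `A⁺¹`. -/
def IsColumnChoice {n d k : ℕ} (A : Matrix (Fin n) (Fin d) ℝ) (L : Fin k → Fin (d + 1)) : Prop :=
  k = (augment A).rank ∧ LinearIndependent ℝ (picked A L).col

/-- The hard-assignment constraint set: 0-1 matrices in which every row sums to one. -/
def hardConstraint (n k : ℕ) : Set (Matrix (Fin n) (Fin k) ℝ) :=
  {C | (∀ i c, C i c = 0 ∨ C i c = 1) ∧ ∀ i, ∑ c, C i c = 1}

/-- `(k, C, L, D)` is a result of DMI-clustering of the rows of `A` under the hard constraint: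
`C` maximizes `det (Cᵀ Ã)` over the constraint set, and `D` is the (genuine) inverse of `Cᵀ Ã`. -/
structure IsDMIClustering {n d : ℕ} (A : Matrix (Fin n) (Fin d) ℝ) (k : ℕ)
    (C : Matrix (Fin n) (Fin k) ℝ) (L : Fin k → Fin (d + 1)) (D : Matrix (Fin k) (Fin k) ℝ) :
    Prop where
  columns : IsColumnChoice A L
  mem : C ∈ hardConstraint n k
  isMax : ∀ C' ∈ hardConstraint n k,
    (C'.transpose * picked A L).det ≤ (C.transpose * picked A L).det
  inverse : IsUnit (C.transpose * picked A L).det ∧ D = (C.transpose * picked A L)⁻¹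

/-- `idxmax M`: the set of all matrices with one-hot rows in which the one of row `i` stands at
a largest entry of row `i` of `M` (a single matrix when there are no ties). -/
def idxmax {n k : ℕ} (M : Matrix (Fin n) (Fin k) ℝ) : Set (Matrix (Fin n) (Fin k) ℝ) :=
  {C | C ∈ hardConstraint n k ∧ ∀ i c, C i c = 1 → ∀ c', M i c' ≤ M i c}

/-- The linear partitions of the rows of `M`: the values of `idxmax (M D)` as `D` ranges over all
`k × k` matrices. -/
def linearPartitions {n k : ℕ} (M : Matrix (Fin n) (Fin k) ℝ) :
    Set (Set (Matrix (Fin n) (Fin k) ℝ)) :=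
  Set.range fun D : Matrix (Fin k) (Fin k) ℝ => idxmax (M * D)

/-! ## The real RAM

Programs work on finitely many named arrays of natural numbers and of real numbers, unbounded and
indexed by natural numbers (a scalar variable is an array of which only cell `0` is used).
Natural numbers can be added, subtracted (truncated at `0`) and compared; real numbers can be
added, subtracted, multiplied, divided and compared exactly.  There is no rounding, no conversion
between the two sorts, and the constants in a program are natural or rational numbers.  Every
operation, array access, comparison, assignment and branch costs one step. -/

structure State where
  nat : ℕ → ℕ → ℕ
  real : ℕ → ℕ → ℝ

/-- Expressions for natural numbers; `get a e` reads cell `e` of array `a`. -/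
inductive NExpr where
  | const (m : ℕ)
  | get (a : ℕ) (e : NExpr)
  | add (e f : NExpr)
  | sub (e f : NExpr)

namespace NExpr

def eval (s : State) : NExpr → ℕ
  | const m => m
  | get a e => s.nat a (e.eval s)
  | add e f => e.eval s + f.eval s
  | sub e f => e.eval s - f.eval s

def cost : NExpr → ℕ
  | const _ => 1
  | get _ e => e.cost + 1
  | add e f => e.cost + f.cost + 1
  | sub e f => e.cost + f.cost + 1

end NExpr

/-- Expressions for real numbers; dividing by `0` gives `0`. -/
inductive RExpr where
  | const (q : ℚ)
  | get (a : ℕ) (e : NExpr)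
  | add (e f : RExpr)
  | sub (e f : RExpr)
  | mul (e f : RExpr)
  | div (e f : RExpr)

namespace RExpr

noncomputable def eval (s : State) : RExpr → ℝ
  | const q => (q : ℝ)
  | get a e => s.real a (e.eval s)
  | add e f => e.eval s + f.eval s
  | sub e f => e.eval s - f.eval s
  | mul e f => e.eval s * f.eval s
  | div e f => e.eval s / f.eval s

def cost : RExpr → ℕ
  | const _ => 1
  | get _ e => e.cost + 1
  | add e f => e.cost + f.cost + 1
  | sub e f => e.cost + f.cost + 1
  | mul e f => e.cost + f.cost + 1
  | div e f => e.cost + f.cost + 1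

end RExpr

/-- Tests. -/
inductive Test where
  | natLt (e f : NExpr)
  | natEq (e f : NExpr)
  | realLt (e f : RExpr)
  | realEq (e f : RExpr)

namespace Test

def holds (s : State) : Test → Prop
  | natLt e f => e.eval s < f.eval s
  | natEq e f => e.eval s = f.eval s
  | realLt e f => e.eval s < f.eval s
  | realEq e f => e.eval s = f.eval s

def cost : Test → ℕ
  | natLt e f => e.cost + f.cost + 1
  | natEq e f => e.cost + f.cost + 1
  | realLt e f => e.cost + f.cost + 1
  | realEq e f => e.cost + f.cost + 1

end Test

/-- Programs; `setNat a e f` writes the value of `f` into cell `e` of array `a`. -/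
inductive Program where
  | skip
  | setNat (a : ℕ) (e f : NExpr)
  | setReal (a : ℕ) (e : NExpr) (f : RExpr)
  | seq (p q : Program)
  | ite (b : Test) (p q : Program)
  | loop (b : Test) (p : Program)

def State.writeNat (s : State) (a i v : ℕ) : State :=
  { s with nat := Function.update s.nat a (Function.update (s.nat a) i v) }

noncomputable def State.writeReal (s : State) (a i : ℕ) (v : ℝ) : State :=
  { s with real := Function.update s.real a (Function.update (s.real a) i v) }

/-- `Run p s t s'`: started in `s`, the program `p` halts after exactly `t` steps in `s'`.
(`loop b p` is the while-loop.) -/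
inductive Run : Program → State → ℕ → State → Prop
  | skip (s : State) : Run .skip s 1 s
  | setNat (a : ℕ) (e f : NExpr) (s : State) :
      Run (.setNat a e f) s (e.cost + f.cost + 1) (s.writeNat a (e.eval s) (f.eval s))
  | setReal (a : ℕ) (e : NExpr) (f : RExpr) (s : State) :
      Run (.setReal a e f) s (e.cost + f.cost + 1) (s.writeReal a (e.eval s) (f.eval s))
  | seq {p q : Program} {s s' s'' : State} {t u : ℕ} :
      Run p s t s' → Run q s' u s'' → Run (.seq p q) s (t + u) s''
  | iteTrue {b : Test} {p q : Program} {s s' : State} {t : ℕ} :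
      b.holds s → Run p s t s' → Run (.ite b p q) s (b.cost + t + 1) s'
  | iteFalse {b : Test} {p q : Program} {s s' : State} {t : ℕ} :
      ¬ b.holds s → Run q s t s' → Run (.ite b p q) s (b.cost + t + 1) s'
  | loopTrue {b : Test} {p : Program} {s s' s'' : State} {t u : ℕ} :
      b.holds s → Run p s t s' → Run (.loop b p) s' u s'' →
      Run (.loop b p) s (b.cost + t + u + 1) s''
  | loopFalse {b : Test} {p : Program} {s : State} :
      ¬ b.holds s → Run (.loop b p) s (b.cost + 1) s

/-! ## Input and output -/

/-- The initial state: cell `0` of the natural-number array `0` holds `n`, the real array `0`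
holds the `n * d` entries of `A` row by row, and every other cell holds `0`. -/
noncomputable def inputState {n d : ℕ} (A : Matrix (Fin n) (Fin d) ℝ) : State where
  nat a i := if a = 0 ∧ i = 0 then n else 0
  real a i := if a = 0 then
      if h : i < n * d then
        A (Fin.divNat ⟨i, h⟩) (Fin.modNat ⟨i, h⟩)
      else 0
    else 0

/-- The output read off a state: `k` in cell `0` of the natural-number array `1`, the column
indices `L` in the natural-number array `2`, the 0-1 matrix `C` row by row in the natural-number
array `3`, and the matrix `D` row by row in the real array `1`. -/
structure HasOutput {n d : ℕ} (s : State) (k : ℕ) (C : Matrix (Fin n) (Fin k) ℝ)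
    (L : Fin k → Fin (d + 1)) (D : Matrix (Fin k) (Fin k) ℝ) : Prop where
  rank : s.nat 1 0 = k
  columns : ∀ j : Fin k, s.nat 2 j = L j
  assignment : ∀ (i : Fin n) (c : Fin k), (s.nat 3 (i * k + c) : ℝ) = C i c
  inverse : ∀ a b : Fin k, s.real 1 (a * k + b) = D a b

/-- The program `p` performs DMI-clustering of `d`-dimensional points under the hard constraint:
on all `n` and all `A` it halts with a correct output after at most `T n` steps. -/
def SolvesDMI (d : ℕ) (p : Program) (T : ℕ → ℕ) : Prop :=
  ∀ (n : ℕ) (A : Matrix (Fin n) (Fin d) ℝ), ∃ (t : ℕ) (s : State),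
    Run p (inputState A) t s ∧ t ≤ T n ∧
      ∃ (k : ℕ) (C : Matrix (Fin n) (Fin k) ℝ) (L : Fin k → Fin (d + 1))
        (D : Matrix (Fin k) (Fin k) ℝ), HasOutput s k C L D ∧ IsDMIClustering A k C L D

end DMI

/-! Write M for `picked A L`, and measure an assignment σ of classes to rows by the determinant of
`(onehot σ)ᵀ * M`. Moving row i to class c changes this matrix by a rank-one term and, when it is
invertible with inverse Y, multiplies its determinant by 1 + (MY)_ic - (MY)_iσ(i)
(`det_onehot_update`). Some assignment has nonzero determinant (`exists_det_ne_zero`), so the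
determinant of a maximizer is nonzero, and each row is sent to a largest entry of its row of MY. The
columns of M span the all-ones vector, so Y can be perturbed to add ε * c to column c of MY. This
breaks ties, and `exists_separable_maximizer` gives a maximizer that is the strict, tie-free argmax
of some MD.

For two classes c, c' such a maximizer is governed by the sides of the rows of M with respect to the
hyperplane normal to the difference of columns c and c' of D. The vectors inducing the same weak
dichotomy form a cone that is spanned by multiples of cross products of k - 1 rows of M. The sum of
k independent such vectors of the cone induces the same strict dichotomy (`exists_crossProducts`),
and positive rescaling of the summands is harmless, so only signs have to be known. Hence k^4
numbers below n + 2, namely row indices and signs, encode a maximizer. For fixed d these are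
polynomially many candidates, and the program tries them all. Each candidate yields a genuine
assignment, so the recorded determinant is attained; the candidate encoding a maximizer makes it
maximal.

No rank computation is needed. Dependent columns only produce zero determinants, which leave the
output alone. As lists are searched by increasing length, the final output stems from rank-many
independent columns. The program has only counting loops, so a polynomial time bound is read off its
structure (`Code.run_compile`).

For the second claim, the value of `idxmax` at MD depends only on the signs of the n * k * k linear
forms (MD)_ic - (MD)_ic' on a space of dimension k * k, and m linear forms on a space of dimension r
realize at most (2m + 1)^r sign vectors (`ncard_signVector_le`). -/

namespace DMI

/-! ## Structured programs

Programs all of whose loops are counting loops.  Array `4` of natural numbers is reserved for the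
loop counters, and the input is never overwritten. -/

/-- Structured code; `count v m p` runs `p` with the counter `v` ranging over the natural numbers
below `n + m`, where `n` is the number of data points. -/
inductive Code where
  | skip
  | setNat (a : ℕ) (e f : NExpr)
  | setReal (a : ℕ) (e : NExpr) (f : RExpr)
  | seq (p q : Code)
  | ite (b : Test) (p q : Code)
  | count (v m : ℕ) (p : Code)

namespace Code

/-- The cell that holds the number of data points, as an expression. -/
def size : NExpr := .get 0 (.const 0)

def compile : Code → Program
  | skip => .skip
  | setNat a e f => .setNat a e f
  | setReal a e f => .setReal a e f
  | seq p q => .seq p.compile q.compile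
  | ite b p q => .ite b p.compile q.compile
  | count v m p =>
      .seq (.setNat 4 (.const v) (.const 0))
        (.loop (.natLt (.get 4 (.const v)) (.add size (.const m)))
          (.seq p.compile (.setNat 4 (.const v) (.add (.get 4 (.const v)) (.const 1)))))

/-- The state after the first `r` rounds of a counting loop with counter `v`. -/
noncomputable def rounds (F : State → State) (v : ℕ) (s : State) : ℕ → State
  | 0 => s
  | r + 1 => F ((rounds F v s r).writeNat 4 v r)

open Classical in
noncomputable def exec : Code → State → State
  | skip, s => s
  | setNat a e f, s => s.writeNat a (e.eval s) (f.eval s)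
  | setReal a e f, s => s.writeReal a (e.eval s) (f.eval s)
  | seq p q, s => q.exec (p.exec s)
  | ite b p q, s => if b.holds s then p.exec s else q.exec s
  | count v m p, s => (rounds p.exec v s (s.nat 0 0 + m)).writeNat 4 v (s.nat 0 0 + m)

theorem exec_seq (p q : Code) (s : State) : (seq p q).exec s = q.exec (p.exec s) := rfl

theorem exec_ite_pos {b : Test} {p q : Code} {s : State} (h : b.holds s) :
    (ite b p q).exec s = p.exec s := by
  rw [exec, if_pos h]

theorem exec_ite_neg {b : Test} {p q : Code} {s : State} (h : ¬ b.holds s) :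
    (ite b p q).exec s = q.exec s := by
  rw [exec, if_neg h]

/-- The counter `v` is used by one of the loops. -/
def Uses (v : ℕ) : Code → Prop
  | skip => False
  | setNat _ _ _ => False
  | setReal _ _ _ => False
  | seq p q => p.Uses v ∨ q.Uses v
  | ite _ p q => p.Uses v ∨ q.Uses v
  | count w _ p => v = w ∨ p.Uses v

/-- The input and the loop counters are written by no assignment, and nested loops have
different counters. -/
def WF : Code → Prop
  | skip => True
  | setNat a _ _ => a ≠ 0 ∧ a ≠ 4
  | setReal a _ _ => a ≠ 0
  | seq p q => p.WF ∧ q.WF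
  | ite _ p q => p.WF ∧ q.WF
  | count v _ p => p.WF ∧ ¬ p.Uses v

/-- Array `a` of natural numbers is not written. -/
def KeepsNat (a : ℕ) : Code → Prop
  | skip => True
  | setNat b _ _ => a ≠ b
  | setReal _ _ _ => True
  | seq p q => p.KeepsNat a ∧ q.KeepsNat a
  | ite _ p q => p.KeepsNat a ∧ q.KeepsNat a
  | count _ _ p => a ≠ 4 ∧ p.KeepsNat a

/-- Array `a` of real numbers is not written. -/
def KeepsReal (a : ℕ) : Code → Prop
  | skip => True
  | setNat _ _ _ => True
  | setReal b _ _ => a ≠ b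
  | seq p q => p.KeepsReal a ∧ q.KeepsReal a
  | ite _ p q => p.KeepsReal a ∧ q.KeepsReal a
  | count _ _ p => p.KeepsReal a

/-- A bound for the number of steps, in terms of the number of data points. -/
noncomputable def time : Code → Polynomial ℕ
  | skip => 1
  | setNat _ e f => Polynomial.C (e.cost + f.cost + 1)
  | setReal _ e f => Polynomial.C (e.cost + f.cost + 1)
  | seq p q => p.time + q.time
  | ite b p q => Polynomial.C (b.cost + 1) + p.time + q.time
  -- A round costs 14 beyond the body: test 7, loop branch 1, increment 6. The 11 is the
  -- initialization, 3, and the final failing test, 8.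
  | count _ m p => (Polynomial.X + Polynomial.C m) * (p.time + 14) + 11

end Code

@[simp] theorem State.writeNat_real (s : State) (a i v : ℕ) :
    (s.writeNat a i v).real = s.real := rfl

@[simp] theorem State.writeReal_nat (s : State) (a i : ℕ) (v : ℝ) :
    (s.writeReal a i v).nat = s.nat := rfl

@[simp] theorem State.writeNat_nat (s : State) (a i v b j : ℕ) :
    (s.writeNat a i v).nat b j = if b = a ∧ j = i then v else s.nat b j := by
  by_cases h : b = a
  · subst h; by_cases h' : j = i <;> simp [State.writeNat, h']
  · simp [State.writeNat, h]

@[simp] theorem State.writeReal_real (s : State) (a i : ℕ) (v : ℝ) (b j : ℕ) :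
    (s.writeReal a i v).real b j = if b = a ∧ j = i then v else s.real b j := by
  by_cases h : b = a
  · subst h; by_cases h' : j = i <;> simp [State.writeReal, h']
  · simp [State.writeReal, h]

/-! ### Semantics and running time of structured code. -/

namespace Code

theorem rounds_induct {F : State → State} {v : ℕ} {s : State} (I : ℕ → State → Prop) {r : ℕ}
    (h0 : I 0 s) (hstep : ∀ i < r, ∀ s, I i s → I (i + 1) (F (s.writeNat 4 v i))) :
    I r (rounds F v s r) := by
  induction r with
  | zero => exact h0
  | succ r ih =>
    exact hstep r (Nat.lt_succ_self r) _ (ih fun i hi => hstep i (Nat.lt_succ_of_lt hi))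

theorem exec_nat_eq {a : ℕ} {p : Code} (hp : p.KeepsNat a) (s : State) (i : ℕ) :
    (p.exec s).nat a i = s.nat a i := by
  induction p generalizing s with
  | skip => rfl
  | setNat b e f => simp only [KeepsNat] at hp; simp [exec, hp]
  | setReal b e f => rfl
  | seq p q ihp ihq => rw [exec, ihq hp.2, ihp hp.1]
  | ite b p q ihp ihq =>
    rw [exec]; split_ifs
    · exact ihp hp.1 s
    · exact ihq hp.2 s
  | count v m p ih =>
    simp only [KeepsNat] at hp
    simp only [exec, State.writeNat_nat, hp.1, false_and, if_false]
    refine rounds_induct (fun _ s' => s'.nat a i = s.nat a i) rfl fun j _ s' hs' => ?_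
    rw [ih hp.2, State.writeNat_nat]
    simp [hp.1, hs']

theorem exec_real_eq {a : ℕ} {p : Code} (hp : p.KeepsReal a) (s : State) (i : ℕ) :
    (p.exec s).real a i = s.real a i := by
  induction p generalizing s with
  | skip => rfl
  | setNat b e f => rfl
  | setReal b e f => simp only [KeepsReal] at hp; simp [exec, hp]
  | seq p q ihp ihq => rw [exec, ihq hp.2, ihp hp.1]
  | ite b p q ihp ihq =>
    rw [exec]; split_ifs
    · exact ihp hp.1 s
    · exact ihq hp.2 s
  | count v m p ih =>
    simp only [exec, State.writeNat_real]
    refine rounds_induct (fun _ s' => s'.real a i = s.real a i) rfl fun j _ s' hs' => ?_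
    rw [ih hp, State.writeNat_real, hs']

theorem WF.keepsNat {p : Code} (hp : p.WF) : p.KeepsNat 0 := by
  induction p with
  | skip => trivial
  | setNat b e f => exact hp.1.symm
  | setReal b e f => trivial
  | seq p q ihp ihq => exact ⟨ihp hp.1, ihq hp.2⟩
  | ite b p q ihp ihq => exact ⟨ihp hp.1, ihq hp.2⟩
  | count v m p ih => exact ⟨by decide, ih hp.1⟩

theorem WF.keepsReal {p : Code} (hp : p.WF) : p.KeepsReal 0 := by
  induction p with
  | skip => trivial
  | setNat b e f => trivial
  | setReal b e f => exact hp.symm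
  | seq p q ihp ihq => exact ⟨ihp hp.1, ihq hp.2⟩
  | ite b p q ihp ihq => exact ⟨ihp hp.1, ihq hp.2⟩
  | count v m p ih => exact ih hp.1

/-- Only loops write to array `4`, each to its own cell. This lets a loop trust its counter after
running its body. -/
theorem exec_counter {p : Code} (hp : p.WF) {v : ℕ} (hv : ¬ p.Uses v) (s : State) :
    (p.exec s).nat 4 v = s.nat 4 v := by
  induction p generalizing s with
  | skip => rfl
  | setNat b e f => simp [exec, hp.2.symm]
  | setReal b e f => rfl
  | seq p q ihp ihq =>
    simp only [Uses, not_or] at hv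
    rw [exec, ihq hp.2 hv.2, ihp hp.1 hv.1]
  | ite b p q ihp ihq =>
    simp only [Uses, not_or] at hv
    rw [exec]; split_ifs
    · exact ihp hp.1 hv.1 s
    · exact ihq hp.2 hv.2 s
  | count w m p ih =>
    simp only [Uses, not_or] at hv
    simp only [exec, State.writeNat_nat, hv.1, and_false, if_false]
    refine rounds_induct (fun _ s' => s'.nat 4 v = s.nat 4 v) rfl fun j _ s' hs' => ?_
    rw [ih hp.1 hv.2, State.writeNat_nat]
    simp [hv.1, hs']

/-- Structured programs halt in polynomial time. -/
theorem run_compile {p : Code} (hp : p.WF) (s : State) :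
    ∃ t, Run p.compile s t (p.exec s) ∧ t ≤ p.time.eval (s.nat 0 0) := by
  induction p generalizing s with
  | skip => exact ⟨1, .skip s, by simp [time]⟩
  | setNat a e f => exact ⟨_, .setNat a e f s, by simp [time]⟩
  | setReal a e f => exact ⟨_, .setReal a e f s, by simp [time]⟩
  | seq p q ihp ihq =>
    obtain ⟨t, ht, ht'⟩ := ihp hp.1 s
    obtain ⟨u, hu, hu'⟩ := ihq hp.2 (p.exec s)
    rw [exec_nat_eq hp.1.keepsNat] at hu'
    exact ⟨t + u, .seq ht hu, by simpa [time] using add_le_add ht' hu'⟩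
  | ite b p q ihp ihq =>
    by_cases h : b.holds s
    · obtain ⟨t, ht, ht'⟩ := ihp hp.1 s
      refine ⟨_, .iteTrue h (by simpa [exec, h] using ht), ?_⟩
      simp only [time, Polynomial.eval_add, Polynomial.eval_C]; omega
    · obtain ⟨t, ht, ht'⟩ := ihq hp.2 s
      refine ⟨_, .iteFalse h (by simpa [exec, h] using ht), ?_⟩
      simp only [time, Polynomial.eval_add, Polynomial.eval_C]; omega
  | count v m p ih =>
    set N := s.nat 0 0 + m with hN
    set b : Test := .natLt (.get 4 (.const v)) (.add size (.const m)) with hb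
    have hround : ∀ r, (rounds p.exec v s r).nat 0 0 = s.nat 0 0 := fun r =>
      rounds_induct (fun _ s' => s'.nat 0 0 = s.nat 0 0) rfl fun j _ s' hs' => by
        rw [exec_nat_eq hp.1.keepsNat, State.writeNat_nat]; simpa using hs'
    -- Induction on the number r of rounds still to be run; the counter has already been set to N -
    -- r.
    have key : ∀ r ≤ N, ∃ t, Run (.loop b (.seq p.compile
        (.setNat 4 (.const v) (.add (.get 4 (.const v)) (.const 1)))))
        ((rounds p.exec v s (N - r)).writeNat 4 v (N - r)) t
        ((rounds p.exec v s N).writeNat 4 v N) ∧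
        t ≤ r * (p.time.eval (s.nat 0 0) + 14) + 8 := by
      intro r
      induction r with
      | zero =>
        intro _
        refine ⟨b.cost + 1, .loopFalse ?_, by simp [hb, Test.cost, NExpr.cost, size]⟩
        simp [hb, Test.holds, NExpr.eval, size, hround, hN]
      | succ r ihr =>
        intro hr
        obtain ⟨u, hu, hu'⟩ := ihr (by omega)
        obtain ⟨t, ht, ht'⟩ := ih hp.1 ((rounds p.exec v s (N - (r + 1))).writeNat 4 v
          (N - (r + 1)))
        have hsucc : N - r = N - (r + 1) + 1 := by omega
        have hcell := exec_counter hp.1 hp.2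
          ((rounds p.exec v s (N - (r + 1))).writeNat 4 v (N - (r + 1)))
        have hset := Run.setNat 4 (.const v) (.add (.get 4 (.const v)) (.const 1))
          (p.exec ((rounds p.exec v s (N - (r + 1))).writeNat 4 v (N - (r + 1))))
        simp only [NExpr.eval, hcell] at hset
        rw [hsucc] at hu
        refine ⟨_, .loopTrue ?_ (.seq ht hset) (by simpa [rounds] using hu), ?_⟩
        · simp [hb, Test.holds, NExpr.eval, size, hround]; omega
        · simp only [State.writeNat_nat, hround] at ht'
          simp only [hb, Test.cost, NExpr.cost, size]
          simp at ht'
          rw [add_mul]; omega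
    obtain ⟨t, ht, ht'⟩ := key N le_rfl
    refine ⟨_, .seq (.setNat 4 _ _ s) (by simpa [rounds, NExpr.eval, exec, ← hN] using ht), ?_⟩
    simp only [time, Polynomial.eval_add, Polynomial.eval_mul, Polynomial.eval_X,
      Polynomial.eval_C, NExpr.cost]
    simp only [Polynomial.eval_ofNat, ← hN]
    omega

/-! ### Derived constructs -/

def each {α : Type} (l : List α) (p : α → Code) : Code :=
  l.foldr (fun a q => seq (p a) q) skip

/-- Run `p 0`, …, `p (m - 1)`. -/
def unroll {m : ℕ} (p : Fin m → Code) : Code :=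
  each (List.finRange m) p

theorem each_induct {α : Type} {l : List α} {p : α → Code} {s : State}
    (I : List α → State → Prop) (h0 : I l s)
    (hstep : ∀ a l s, I (a :: l) s → I l ((p a).exec s)) : I [] ((each l p).exec s) := by
  induction l generalizing s with
  | nil => exact h0
  | cons a l ih => exact ih (hstep a l s h0)

theorem unroll_induct {m : ℕ} {p : Fin m → Code} {s : State} (I : ℕ → State → Prop)
    (h0 : I 0 s) (hstep : ∀ (c : Fin m) s, I c s → I (c + 1) ((p c).exec s)) :
    I m ((unroll p).exec s) := by
  -- The invariant of `each_induct` sees the list still to be run, so m - l.length is the number of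
  -- blocks already executed.
  have h := each_induct (l := List.finRange m) (p := p) (s := s)
    (fun l s => l = (List.finRange m).drop (m - l.length) ∧ l.length ≤ m ∧ I (m - l.length) s)
    (by simpa using h0) ?_
  · simpa [unroll] using h.2.2
  · rintro a l s ⟨h1, h2, h3⟩
    simp only [List.length_cons] at h1 h2 h3
    have hlt : m - (l.length + 1) < (List.finRange m).length := by simp; omega
    rw [List.drop_eq_getElem_cons hlt, List.cons.injEq] at h1
    have e : m - (l.length + 1) + 1 = m - l.length := by omega
    rw [e] at h1
    refine ⟨h1.2, by omega, ?_⟩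
    rw [← e]
    have ha : (a : ℕ) = m - (l.length + 1) := by rw [h1.1]; simp
    rw [← ha] at h3 ⊢
    exact hstep a s h3

section
variable {α : Type} {l : List α} {p : α → Code}

theorem each_wf : (each l p).WF ↔ ∀ a ∈ l, (p a).WF := by
  induction l with
  | nil => simp [each, WF]
  | cons a l ih => rw [List.forall_mem_cons, ← ih]; rfl

theorem each_uses {v : ℕ} : (each l p).Uses v ↔ ∃ a ∈ l, (p a).Uses v := by
  induction l with
  | nil => simp [each, Uses]
  | cons a l ih => rw [List.exists_mem_cons_iff, ← ih]; rfl

theorem each_keepsNat {i : ℕ} : (each l p).KeepsNat i ↔ ∀ a ∈ l, (p a).KeepsNat i := by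
  induction l with
  | nil => simp [each, KeepsNat]
  | cons a l ih => rw [List.forall_mem_cons, ← ih]; rfl

theorem each_keepsReal {i : ℕ} : (each l p).KeepsReal i ↔ ∀ a ∈ l, (p a).KeepsReal i := by
  induction l with
  | nil => simp [each, KeepsReal]
  | cons a l ih => rw [List.forall_mem_cons, ← ih]; rfl

end

section
variable {m : ℕ} {p : Fin m → Code}

@[simp] theorem unroll_wf : (unroll p).WF ↔ ∀ c, (p c).WF := by
  simp [unroll, each_wf]

@[simp] theorem unroll_uses {v : ℕ} : (unroll p).Uses v ↔ ∃ c, (p c).Uses v := by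
  simp [unroll, each_uses]

@[simp] theorem unroll_keepsNat {i : ℕ} : (unroll p).KeepsNat i ↔ ∀ c, (p c).KeepsNat i := by
  simp [unroll, each_keepsNat]

@[simp] theorem unroll_keepsReal {i : ℕ} : (unroll p).KeepsReal i ↔ ∀ c, (p c).KeepsReal i := by
  simp [unroll, each_keepsReal]

end

/-- `m` nested loops over `0, …, n + 1`, with counters `0, …, m - 1`. -/
def nest (p : Code) : ℕ → Code
  | 0 => p
  | m + 1 => count m 2 (nest p m)

theorem nest_uses {p : Code} {m v : ℕ} (hm : m ≤ v) (hv : ¬ p.Uses v) : ¬ (nest p m).Uses v := by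
  induction m with
  | zero => exact hv
  | succ m ih => exact not_or.2 ⟨by omega, ih (by omega)⟩

theorem nest_wf {p : Code} {m : ℕ} (hp : p.WF) (hv : ∀ v < m, ¬ p.Uses v) : (nest p m).WF := by
  induction m with
  | zero => exact hp
  | succ m ih =>
    exact ⟨ih fun v hv' => hv v (by omega), nest_uses le_rfl (hv m (by omega))⟩

/-- If the body establishes `Q` for one choice `x` of the counters, then the nested loops
establish `Q`. -/
theorem nest_spec {p : Code} (hp : p.WF) {M n : ℕ} (hv : ∀ v < M, ¬ p.Uses v)
    (x : ℕ → ℕ) (hx : ∀ v, x v < n + 2) (I Q : State → Prop)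
    (hn : ∀ s, I s → s.nat 0 0 = n)
    (hI : ∀ s v r, I s → I (s.writeNat 4 v r)) (hQ : ∀ s v r, Q s → Q (s.writeNat 4 v r))
    (hpI : ∀ s, I s → I (p.exec s)) (hpQ : ∀ s, I s → Q s → Q (p.exec s))
    (hit : ∀ s, I s → (∀ v < M, s.nat 4 v = x v) → Q (p.exec s)) {m : ℕ} (hm : m ≤ M)
    (s : State) (hs : I s) :
    I ((nest p m).exec s) ∧ (Q s → Q ((nest p m).exec s)) ∧
      ((∀ v < M, m ≤ v → s.nat 4 v = x v) → Q ((nest p m).exec s)) := by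
  induction m generalizing s with
  | zero => exact ⟨hpI s hs, hpQ s hs, fun h => hit s hs fun v hv => h v hv (Nat.zero_le v)⟩
  | succ m ih =>
    have ih := ih (by omega)
    have hwf : (nest p m).WF := nest_wf hp fun v hv' => hv v (by omega)
    simp only [nest, exec, hn s hs]
    refine ⟨hI _ _ _ ?_, fun hq => hQ _ _ _ ?_, fun h => hQ _ _ _ ?_⟩
    · exact rounds_induct (fun _ s => I s) hs fun i _ s hs => (ih _ (hI _ _ _ hs)).1
    · exact (rounds_induct (fun _ s => I s ∧ Q s) ⟨hs, hq⟩ fun i _ s hs =>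
        ⟨(ih _ (hI _ _ _ hs.1)).1, (ih _ (hI _ _ _ hs.1)).2.1 (hQ _ _ _ hs.2)⟩).2
    -- Once round x m is over, Q holds, and it persists through the later rounds.
    · refine (rounds_induct (fun i s => I s ∧ (∀ v < M, m + 1 ≤ v → s.nat 4 v = x v) ∧
        (x m < i → Q s)) ⟨hs, h, by simp⟩ fun i _ s hs => ⟨(ih _ (hI _ _ _ hs.1)).1, ?_, ?_⟩).2.2
        (hx m)
      · intro v hvM hmv
        rw [exec_counter hwf (nest_uses (by omega) (hv v hvM)), State.writeNat_nat,
          if_neg (by omega), hs.2.1 v hvM hmv]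
      · intro hi
        rcases (Nat.lt_succ_iff.1 hi).lt_or_eq with hlt | heq
        · exact (ih _ (hI _ _ _ hs.1)).2.1 (hQ _ _ _ (hs.2.2 hlt))
        · refine (ih _ (hI _ _ _ hs.1)).2.2 fun v hvM hmv => ?_
          rw [State.writeNat_nat]
          by_cases hvm : v = m
          · simp [hvm, heq]
          · rw [if_neg (by omega), hs.2.1 v hvM (by omega)]

end Code

/-! ## Dichotomies by cross products -/

open Matrix

section Cone

variable {m : ℕ}

/-- The generalized cross product of the first `m` rows of `A`. -/
def crossProduct (A : Matrix (Fin (m + 1)) (Fin (m + 1)) ℝ) : Fin (m + 1) → ℝ :=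
  fun j => A.adjugate j (Fin.last m)

/-- Cramer's rule: these cofactors do not involve the last row of A, which can therefore be replaced
by x. -/
theorem dotProduct_crossProduct (A : Matrix (Fin (m + 1)) (Fin (m + 1)) ℝ)
    (x : Fin (m + 1) → ℝ) : x ⬝ᵥ crossProduct A = (A.updateRow (Fin.last m) x).det := by
  rw [← cramer_transpose_apply, cramer_eq_adjugate_mulVec, ← adjugate_transpose, mulVec,
    dotProduct_comm]
  rfl

variable {ι : Type} (a : ι → Fin (m + 1) → ℝ) (w : Fin (m + 1) → ℝ)

/-- The closed cone of the vectors on the same sides as `w`. -/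
def sameSides : Set (Fin (m + 1) → ℝ) := {v | ∀ i, 0 ≤ (a i ⬝ᵥ w) * (a i ⬝ᵥ v)}

/-- The vectors orthogonal to every `a i` that is orthogonal to `v`. -/
def carrier (v : Fin (m + 1) → ℝ) : Submodule ℝ (Fin (m + 1) → ℝ) where
  carrier := {u | ∀ i, a i ⬝ᵥ v = 0 → a i ⬝ᵥ u = 0}
  add_mem' hx hy i hi := by rw [dotProduct_add, hx i hi, hy i hi, add_zero]
  zero_mem' i _ := dotProduct_zero _
  smul_mem' c x hx i hi := by rw [dotProduct_smul, hx i hi, smul_zero]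

/-- The vectors of the cone that are multiples of cross products. -/
def extremeRays : Set (Fin (m + 1) → ℝ) :=
  {v | v ∈ sameSides a w ∧
    ∃ (f : Fin (m + 1) → ι) (c : ℝ), v = c • crossProduct (of fun l => a (f l))}

variable {a w}

theorem dotProduct_eq_zero_of_mem_span {k : ℕ} {b : Set (Fin k → ℝ)} {v : Fin k → ℝ}
    (h : ∀ x ∈ b, x ⬝ᵥ v = 0) {x : Fin k → ℝ} (hx : x ∈ Submodule.span ℝ b) : x ⬝ᵥ v = 0 := by
  induction hx using Submodule.span_induction with
  | mem x hx => exact h x hx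
  | zero => exact zero_dotProduct _
  | add x y _ _ hx hy => rw [add_dotProduct, hx, hy, add_zero]
  | smul c x _ hx => rw [smul_dotProduct, hx, smul_zero]

theorem det_snoc_ne_zero_iff {g : Fin m → Fin (m + 1) → ℝ} {x : Fin (m + 1) → ℝ} :
    (of (Fin.snoc (α := fun _ => Fin (m + 1) → ℝ) g x)).det ≠ 0 ↔
      LinearIndependent ℝ (Fin.snoc (α := fun _ => Fin (m + 1) → ℝ) g x) := by
  rw [← isUnit_iff_ne_zero, ← isUnit_iff_isUnit_det, ← linearIndependent_rows_iff_isUnit]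
  rfl

/-- The carrier is the orthogonal complement of the tight vectors, those a i orthogonal to v. If it
is at most a line, m tight vectors are independent, and their cross product lies on that line. -/
theorem exists_eq_smul_crossProduct [Fintype ι] {v : Fin (m + 1) → ℝ} (hv : v ≠ 0) (i₀ : ι)
    (h : Module.finrank ℝ (carrier a v) ≤ 1) :
    ∃ (f : Fin (m + 1) → ι) (c : ℝ), v = c • crossProduct (of fun l => a (f l)) := by
  classical
  let B : Matrix {i // a i ⬝ᵥ v = 0} (Fin (m + 1)) ℝ := of fun i => a i
  have hker : LinearMap.ker B.mulVecLin = carrier a v := by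
    ext x
    simp only [LinearMap.mem_ker, mulVecLin_apply, funext_iff, Subtype.forall]
    rfl
  have hrank : m ≤ Module.finrank ℝ (Submodule.span ℝ (Set.range B.row)) := by
    have h1 := LinearMap.finrank_range_add_finrank_ker B.mulVecLin
    rw [hker, Module.finrank_fin_fun] at h1
    rw [← rank_eq_finrank_span_row, rank]
    omega
  obtain ⟨b, hb, hspan, hli⟩ := exists_linearIndependent ℝ (Set.range B.row)
  have hfin : b.Finite := (Set.finite_range _).subset hb
  have := hfin.fintype
  have hcard : m ≤ Fintype.card b := by
    rw [← hspan, finrank_span_set_eq_card hli, Set.toFinset_card] at hrank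
    exact hrank
  obtain ⟨g⟩ : Nonempty (Fin m ↪ b) :=
    Function.Embedding.nonempty_of_card_le (by simpa using hcard)
  have hg : ∀ l, ∃ i : {i // a i ⬝ᵥ v = 0}, a i = g l := fun l => hb (g l).2
  choose f hf using hg
  -- The last row does not enter the cross product, so i₀ is a mere filler.
  let F : Fin (m + 1) → ι := Fin.snoc (α := fun _ => ι) (fun l => (f l : ι)) i₀
  set A : Matrix (Fin (m + 1)) (Fin (m + 1)) ℝ := of fun l => a (F l) with hA
  have hrows : ∀ x, (A.updateRow (Fin.last m) x) =
      of (Fin.snoc (α := fun _ => Fin (m + 1) → ℝ) (fun l => (g l : Fin (m + 1) → ℝ)) x) := by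
    intro x
    ext l j
    refine Fin.lastCases ?_ (fun l => ?_) l
    · simp
    · rw [updateRow_ne (Fin.castSucc_lt_last l).ne]
      simp [hA, F, hf]
  have hligs : LinearIndependent ℝ (fun l => (g l : Fin (m + 1) → ℝ)) :=
    hli.comp g g.injective
  have horth : ∀ x ∈ Submodule.span ℝ (Set.range fun l => (g l : Fin (m + 1) → ℝ)),
      x ⬝ᵥ v = 0 := by
    intro x hx
    refine dotProduct_eq_zero_of_mem_span ?_ hx
    rintro _ ⟨l, rfl⟩
    simp only [← hf]
    exact (f l).2
  have hdet : (A.updateRow (Fin.last m) v).det ≠ 0 := by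
    rw [hrows, det_snoc_ne_zero_iff]
    refine linearIndependent_finSnoc.2 ⟨hligs, fun hmem => hv ?_⟩
    exact dotProduct_self_eq_zero.1 (horth v hmem)
  have hv' : v ∈ carrier a v := fun i hi => hi
  have hone : ∀ u ∈ carrier a v, ∃ c : ℝ, c • v = u := by
    have hpos : Module.finrank ℝ (carrier a v) = 1 := by
      refine le_antisymm h (Nat.one_le_iff_ne_zero.2 fun h0 => hv ?_)
      have := Submodule.finrank_eq_zero.1 h0
      rw [this] at hv'
      exact (Submodule.mem_bot ℝ).1 hv'
    intro u hu
    obtain ⟨c, hc⟩ := (finrank_eq_one_iff_of_nonzero' (⟨v, hv'⟩ : carrier a v)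
      (fun h0 => hv (congrArg Subtype.val h0))).1 hpos ⟨u, hu⟩
    exact ⟨c, congrArg Subtype.val hc⟩
  -- A tight vector not orthogonal to the cross product would give m + 1 independent tight vectors,
  -- forcing v = 0.
  have hmem : crossProduct A ∈ carrier a v := by
    intro i hi
    rw [dotProduct_crossProduct]
    by_contra hne
    rw [hrows] at hne
    have hlis := det_snoc_ne_zero_iff.1 hne
    have hsub : Submodule.span ℝ (Set.range (Fin.snoc (α := fun _ => Fin (m + 1) → ℝ)
        (fun l => (g l : Fin (m + 1) → ℝ)) (a i))) ≤ Submodule.span ℝ (Set.range B.row) := by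
      rw [Submodule.span_le]
      rintro _ ⟨l, rfl⟩
      refine Fin.lastCases ?_ (fun l => ?_) l
      · simp only [Fin.snoc_last]; exact Submodule.subset_span ⟨⟨i, hi⟩, rfl⟩
      · simp only [Fin.snoc_castSucc]; exact Submodule.subset_span (hb (g l).2)
    have h1 := Submodule.finrank_mono hsub
    rw [finrank_span_eq_card hlis, Fintype.card_fin] at h1
    have h2 := LinearMap.finrank_range_add_finrank_ker B.mulVecLin
    rw [hker, Module.finrank_fin_fun, ← rank, rank_eq_finrank_span_row] at h2
    have h3 : Module.finrank ℝ (carrier a v) = 0 := by omega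
    have := Submodule.finrank_eq_zero.1 h3
    rw [this] at hv'
    exact hv ((Submodule.mem_bot ℝ).1 hv')
  obtain ⟨c, hc⟩ := hone _ hmem
  have hc0 : c ≠ 0 := by
    rintro rfl
    rw [zero_smul] at hc
    rw [← dotProduct_crossProduct, ← hc, dotProduct_zero] at hdet
    exact hdet rfl
  exact ⟨F, c⁻¹, by rw [← hA, ← hc, smul_smul, inv_mul_cancel₀ hc0, one_smul]⟩

/-- Moving in the cone until another constraint becomes tight. -/
theorem exists_tight [Fintype ι] {v u : Fin (m + 1) → ℝ} (hv : v ∈ sameSides a w)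
    (hu : u ∈ carrier a v) (hneg : ∃ i, (a i ⬝ᵥ w) * (a i ⬝ᵥ u) < 0) :
    ∃ t : ℝ, 0 < t ∧ v + t • u ∈ sameSides a w ∧ carrier a (v + t • u) < carrier a v := by
  classical
  have hpos : ∀ i, (a i ⬝ᵥ w) * (a i ⬝ᵥ u) < 0 → 0 < (a i ⬝ᵥ w) * (a i ⬝ᵥ v) := by
    intro i hi
    refine lt_of_le_of_ne (hv i) fun h0 => ?_
    rcases mul_eq_zero.1 h0.symm with h | h
    · rw [h, zero_mul] at hi; exact lt_irrefl _ hi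
    · rw [hu i h, mul_zero] at hi; exact lt_irrefl _ hi
  -- The ratio is the time at which a decreasing constraint reaches zero; the smallest one is the
  -- exit time from the cone.
  obtain ⟨i, hi, hmin⟩ := Finset.exists_min_image
    (Finset.univ.filter fun i => (a i ⬝ᵥ w) * (a i ⬝ᵥ u) < 0)
    (fun i => (a i ⬝ᵥ w) * (a i ⬝ᵥ v) / -((a i ⬝ᵥ w) * (a i ⬝ᵥ u)))
    (by obtain ⟨i, hi⟩ := hneg; exact ⟨i, by simpa using hi⟩)
  simp only [Finset.mem_filter, Finset.mem_univ, true_and] at hi hmin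
  set t := (a i ⬝ᵥ w) * (a i ⬝ᵥ v) / -((a i ⬝ᵥ w) * (a i ⬝ᵥ u)) with ht
  have htpos : 0 < t := div_pos (hpos i hi) (neg_pos.2 hi)
  refine ⟨t, htpos, fun j => ?_, ?_⟩
  · rw [dotProduct_add, dotProduct_smul, smul_eq_mul, mul_add]
    by_cases hj : (a j ⬝ᵥ w) * (a j ⬝ᵥ u) < 0
    · have := (le_div_iff₀ (neg_pos.2 hj)).1 (hmin j hj)
      linarith
    · have h1 := hv j
      have h2 := mul_nonneg htpos.le (not_lt.1 hj)
      linarith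
  -- Tight constraints stay tight along u. The inclusion is strict because constraint i becomes
  -- tight while u is not orthogonal to a i.
  · refine lt_of_le_of_ne (fun x hx j hj => hx j ?_) fun heq => ?_
    · rw [dotProduct_add, dotProduct_smul, hu j hj, hj, smul_zero, add_zero]
    · have hmem : u ∈ carrier a (v + t • u) := heq ▸ hu
      have hw : a i ⬝ᵥ w ≠ 0 := fun h => by simp [h] at hi
      have hu0 : a i ⬝ᵥ u ≠ 0 := fun h => by simp [h] at hi
      refine hu0 (hmem i ?_)
      rw [dotProduct_add, dotProduct_smul, smul_eq_mul, ht]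
      field_simp
      ring

/-- Induction on the dimension of the carrier. If it is at least two, there is a direction u in it
along which the cone is left both ways; v is a combination of the two exit points, whose carriers
are smaller. -/
theorem sameSides_subset_span [Fintype ι] (hspan : ∀ v, (∀ i, a i ⬝ᵥ v = 0) → v = 0)
    (hw : ∀ i, a i ⬝ᵥ w ≠ 0) (i₀ : ι) {v : Fin (m + 1) → ℝ} (hv : v ∈ sameSides a w) :
    v ∈ Submodule.span ℝ (extremeRays a w) := by
  induction hr : Module.finrank ℝ (carrier a v) using Nat.strong_induction_on generalizing v with
  | _ r ih =>
    subst hr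
    by_cases hv0 : v = 0
    · rw [hv0]; exact zero_mem _
    rcases le_or_gt (Module.finrank ℝ (carrier a v)) 1 with h1 | h1
    · exact Submodule.subset_span ⟨hv, exists_eq_smul_crossProduct hv0 i₀ h1⟩
    -- A nonzero u in the kernel of φ has products (a i ⬝ᵥ w) * (a i ⬝ᵥ u) that sum to zero without
    -- all vanishing, hence of both signs.
    let φ : (Fin (m + 1) → ℝ) →ₗ[ℝ] ℝ :=
      { toFun := fun x => ∑ i, (a i ⬝ᵥ w) * (a i ⬝ᵥ x)
        map_add' := fun x y => by simp [dotProduct_add, mul_add, Finset.sum_add_distrib]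
        map_smul' := fun c x => by
          simp only [dotProduct_smul, smul_eq_mul, RingHom.id_apply, Finset.mul_sum]
          exact Finset.sum_congr rfl fun i _ => by ring }
    obtain ⟨⟨u, hu⟩, huφ, hu0⟩ := Submodule.exists_mem_ne_zero_of_ne_bot
      (LinearMap.ker_ne_bot_of_finrank_lt (f := φ.domRestrict (carrier a v))
        (by rwa [Module.finrank_self]))
    have hu0 : u ≠ 0 := fun h => hu0 (Subtype.ext h)
    have hsum : ∑ i, (a i ⬝ᵥ w) * (a i ⬝ᵥ u) = 0 := huφ
    have hex : ∃ i, (a i ⬝ᵥ w) * (a i ⬝ᵥ u) ≠ 0 := by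
      by_contra! h
      exact hu0 (hspan u fun i => (mul_eq_zero.1 (h i)).resolve_left (hw i))
    obtain ⟨i, hi⟩ := hex
    have hneg : ∃ i, (a i ⬝ᵥ w) * (a i ⬝ᵥ u) < 0 := by
      by_contra! h
      exact hi ((Finset.sum_eq_zero_iff_of_nonneg fun i _ => h i).1 hsum i (Finset.mem_univ i))
    have hpos : ∃ i, (a i ⬝ᵥ w) * (a i ⬝ᵥ -u) < 0 := by
      by_contra! h
      simp only [dotProduct_neg, mul_neg, Left.nonneg_neg_iff] at h
      exact hi ((Finset.sum_eq_zero_iff_of_nonpos fun i _ => h i).1 hsum i (Finset.mem_univ i))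
    obtain ⟨t, ht, htm, htc⟩ := exists_tight hv hu hneg
    obtain ⟨r, hr, hrm, hrc⟩ := exists_tight hv (neg_mem hu) hpos
    have h2 := ih _ (Submodule.finrank_lt_finrank_of_lt htc) htm rfl
    have h3 := ih _ (Submodule.finrank_lt_finrank_of_lt hrc) hrm rfl
    have hv' : v = (t + r)⁻¹ • (r • (v + t • u) + t • (v + r • -u)) := by
      have h : r • (v + t • u) + t • (v + r • -u) = (t + r) • v := by module
      rw [h, smul_smul, inv_mul_cancel₀ (by positivity), one_smul]
    rw [hv']
    exact Submodule.smul_mem _ _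
      (Submodule.add_mem _ (Submodule.smul_mem _ _ h2) (Submodule.smul_mem _ _ h3))

/-- The vector w is interior to the cone, so w + ε • x stays in it for small ε > 0, and x is
recovered from a difference. -/
theorem span_extremeRays [Fintype ι] (hspan : ∀ v, (∀ i, a i ⬝ᵥ v = 0) → v = 0)
    (hw : ∀ i, a i ⬝ᵥ w ≠ 0) (i₀ : ι) : Submodule.span ℝ (extremeRays a w) = ⊤ := by
  rw [eq_top_iff]
  intro x _
  have hev : ∀ᶠ ε : ℝ in nhdsWithin 0 (Set.Ioi 0), w + ε • x ∈ sameSides a w := by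
    refine Filter.Eventually.filter_mono nhdsWithin_le_nhds ?_
    refine Filter.eventually_all.2 fun i => ?_
    have hcont : Continuous fun ε : ℝ => (a i ⬝ᵥ w) * (a i ⬝ᵥ (w + ε • x)) := by
      simp only [dotProduct_add, dotProduct_smul]
      fun_prop
    have h0 : 0 < (a i ⬝ᵥ w) * (a i ⬝ᵥ (w + (0 : ℝ) • x)) := by
      rw [zero_smul, add_zero]; exact mul_self_pos.2 (hw i)
    exact (hcont.continuousAt.eventually (lt_mem_nhds h0)).mono fun ε h => h.le
  obtain ⟨ε, hε, hpos⟩ := (hev.and self_mem_nhdsWithin).exists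
  have h1 := sameSides_subset_span hspan hw i₀ hε
  have h2 := sameSides_subset_span hspan hw i₀ (w := w) (v := w)
    fun i => mul_self_nonneg _
  have hx : x = ε⁻¹ • ((w + ε • x) - w) := by
    rw [add_sub_cancel_left, smul_smul, inv_mul_cancel₀ (ne_of_gt hpos), one_smul]
  rw [hx]
  exact Submodule.smul_mem _ _ (Submodule.sub_mem _ h1 h2)

/-- Every dichotomy of spanning vectors `a i` by a hyperplane through the origin that contains
none of them is the dichotomy by a signed sum of `m + 1` cross products of the `a i`. -/
theorem exists_crossProducts [Fintype ι] (hspan : ∀ v, (∀ i, a i ⬝ᵥ v = 0) → v = 0)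
    (hw : ∀ i, a i ⬝ᵥ w ≠ 0) :
    ∃ (f : Fin (m + 1) → Fin (m + 1) → ι) (s : Fin (m + 1) → ℝ), (∀ j, s j = 1 ∨ s j = -1) ∧
      ∀ i, 0 < a i ⬝ᵥ w ↔
        0 < ∑ j, s j * ((of fun l => a (f j l)).updateRow (Fin.last m) (a i)).det := by
  have hne : Nonempty ι := by
    by_contra h
    rw [not_nonempty_iff] at h
    exact one_ne_zero (hspan 1 fun i => h.elim i)
  obtain ⟨i₀⟩ := hne
  obtain ⟨b, hb, hbspan, hli⟩ := exists_linearIndependent ℝ (extremeRays a w)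
  rw [span_extremeRays hspan hw i₀] at hbspan
  let B : Module.Basis b ℝ (Fin (m + 1) → ℝ) := .mk hli (by simp [hbspan])
  have : Fintype b := FiniteDimensional.fintypeBasisIndex B
  have hcard : Fintype.card (Fin (m + 1)) = Fintype.card b := by
    rw [← Module.finrank_eq_card_basis B, Module.finrank_fin_fun, Fintype.card_fin]
  let e := Fintype.equivOfCardEq hcard
  have hg : ∀ j, (e j : Fin (m + 1) → ℝ) ∈ extremeRays a w := fun j => hb (e j).2
  choose hcone f c hc using hg
  have hc0 : ∀ j, c j ≠ 0 := by
    intro j h0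
    have h1 := hc j
    rw [h0, zero_smul] at h1
    exact hli.ne_zero (e j) h1
  -- Keeping only the sign of c j rescales the j-th basis vector by the positive factor |c j|⁻¹,
  -- which does not leave the cone.
  refine ⟨f, fun j => if 0 < c j then 1 else -1, fun j => by
    by_cases h : 0 < c j <;> simp [h], fun i => ?_⟩
  have hsum : ∑ j, (if 0 < c j then (1 : ℝ) else -1) *
      ((of fun l => a (f j l)).updateRow (Fin.last m) (a i)).det =
      ∑ j, |c j|⁻¹ * (a i ⬝ᵥ (e j : Fin (m + 1) → ℝ)) := by
    refine Finset.sum_congr rfl fun j _ => ?_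
    rw [hc j, dotProduct_smul, dotProduct_crossProduct, smul_eq_mul, ← mul_assoc]
    congr 1
    split_ifs with h
    · rw [abs_of_pos h, inv_mul_cancel₀ (hc0 j)]
    · rw [abs_of_neg (lt_of_le_of_ne (not_lt.1 h) (hc0 j)), inv_neg, neg_mul,
        inv_mul_cancel₀ (hc0 j)]
  rw [hsum]
  have hpos : 0 < (a i ⬝ᵥ w) * ∑ j, |c j|⁻¹ * (a i ⬝ᵥ (e j : Fin (m + 1) → ℝ)) := by
    rw [Finset.mul_sum]
    have hnn : ∀ j ∈ Finset.univ, 0 ≤ (a i ⬝ᵥ w) * (|c j|⁻¹ * (a i ⬝ᵥ (e j : Fin (m + 1) → ℝ))) :=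
      fun j _ => by
        rw [mul_left_comm]
        exact mul_nonneg (inv_nonneg.2 (abs_nonneg _)) (hcone j i)
    -- If all terms vanished, a i would be orthogonal to a basis and hence to w.
    refine lt_of_le_of_ne (Finset.sum_nonneg hnn) fun h0 => hw i ?_
    have hz := (Finset.sum_eq_zero_iff_of_nonneg hnn).1 h0.symm
    have hz' : ∀ x ∈ b, a i ⬝ᵥ x = 0 := by
      intro x hx
      have := hz (e.symm ⟨x, hx⟩) (Finset.mem_univ _)
      simpa [hw i, hc0] using this
    have hwmem : w ∈ Submodule.span ℝ b := by rw [hbspan]; trivial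
    rw [dotProduct_comm]
    exact dotProduct_eq_zero_of_mem_span (fun x hx => by rw [dotProduct_comm, hz' x hx]) hwmem
  constructor
  · exact fun h => (mul_pos_iff_of_pos_left h).1 hpos
  · exact fun h => (mul_pos_iff_of_pos_right h).1 hpos

end Cone

/-! ## Optimal hard assignments are linearly separable -/

section Assignments

variable {n k : ℕ}

/-- The 0-1 matrix of an assignment of classes. -/
def onehot (σ : Fin n → Fin k) : Matrix (Fin n) (Fin k) ℝ :=
  of fun i => Pi.single (σ i) 1

theorem onehot_apply (σ : Fin n → Fin k) (i : Fin n) (c : Fin k) :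
    onehot σ i c = if c = σ i then 1 else 0 := by
  simp [onehot, Pi.single_apply]

theorem onehot_mem (σ : Fin n → Fin k) : onehot σ ∈ hardConstraint n k := by
  refine ⟨fun i c => ?_, fun i => ?_⟩
  · rw [onehot_apply]; split_ifs <;> simp
  · simp [onehot_apply]

theorem exists_onehot_eq {C : Matrix (Fin n) (Fin k) ℝ} (hC : C ∈ hardConstraint n k) :
    ∃ σ, C = onehot σ := by
  have h : ∀ i, ∃ c, C i c = 1 := by
    intro i
    by_contra! h
    have h0 : ∀ c, C i c = 0 := fun c => (hC.1 i c).resolve_right (h c)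
    have := hC.2 i
    simp [h0] at this
  choose σ hσ using h
  refine ⟨σ, ?_⟩
  ext i c
  rw [onehot_apply]
  split_ifs with hc
  · rw [hc, hσ]
  · refine (hC.1 i c).resolve_right fun h1 => ?_
    have hnn : ∀ c ∈ Finset.univ, 0 ≤ C i c := fun c _ => by rcases hC.1 i c with h | h <;> simp [h]
    have hle : ∑ c ∈ {σ i, c}, C i c ≤ ∑ c, C i c :=
      Finset.sum_le_sum_of_subset_of_nonneg (Finset.subset_univ _) fun c hc _ => hnn c hc
    rw [Finset.sum_pair (Ne.symm hc), hσ, h1, hC.2 i] at hle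
    norm_num at hle

/-- Isolates the contribution of row i as a rank-one term. -/
theorem transpose_updateRow_mul (C M : Matrix (Fin n) (Fin k) ℝ) (i : Fin n) (r : Fin k → ℝ) :
    (C.updateRow i r)ᵀ * M = (C.updateRow i 0)ᵀ * M + vecMulVec r (M i) := by
  ext a b
  rw [Matrix.add_apply, vecMulVec_apply, mul_apply, mul_apply,
    ← Finset.add_sum_erase _ _ (Finset.mem_univ i),
    ← Finset.add_sum_erase Finset.univ (fun j => (C.updateRow i 0)ᵀ a j * M j b)
      (Finset.mem_univ i)]
  have h : ∀ r : Fin k → ℝ, ∑ x ∈ Finset.univ.erase i, (C.updateRow i r)ᵀ a x * M x b =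
      ∑ x ∈ Finset.univ.erase i, C x a * M x b := fun r =>
    Finset.sum_congr rfl fun x hx => by
      rw [transpose_apply, updateRow_ne (Finset.ne_of_mem_erase hx)]
  rw [h, h]
  simp [add_comm]

/-- The determinant is affine along rank-one updates. -/
theorem det_add_vecMulVec_sum (X : Matrix (Fin k) (Fin k) ℝ) (v : Fin k → ℝ) {ι : Type}
    [Fintype ι] (c : ι → ℝ) (hc : ∑ j, c j = 1) (u : ι → Fin k → ℝ) :
    (X + vecMulVec (∑ j, c j • u j) v).det = ∑ j, c j * (X + vecMulVec (u j) v).det := by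
  -- By the Schur complement, det (X + u vᵀ) is the determinant of X bordered by the column -u, the
  -- row v and the corner 1. It is linear in the last column, and the corner is respected since the
  -- c j sum to one.
  let B : Matrix (Fin k ⊕ Unit) (Fin k ⊕ Unit) ℝ := fromBlocks X 0 (replicateRow Unit v) 0
  let F : (Fin k ⊕ Unit → ℝ) →ₗ[ℝ] ℝ := LinearMap.proj (Sum.inr ()) ∘ₗ cramer B
  have hF : ∀ u, (X + vecMulVec u v).det = F (Sum.elim (-u) 1) := by
    intro u
    have h1 : F (Sum.elim (-u) 1) = (B.updateCol (Sum.inr ()) (Sum.elim (-u) 1)).det := by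
      simp [F, cramer_apply]
    have h2 : B.updateCol (Sum.inr ()) (Sum.elim (-u) 1) =
        fromBlocks X (replicateCol Unit (-u)) (replicateRow Unit v) 1 := by
      ext a b
      rcases a with a | a <;> rcases b with b | b <;> simp [B]
    rw [h1, h2, det_fromBlocks_one₂₂]
    congr 1
    ext a b
    simp [vecMulVec_apply, mul_apply]
  simp only [hF]
  have : (Sum.elim (-∑ j, c j • u j) 1 : Fin k ⊕ Unit → ℝ) = ∑ j, c j • Sum.elim (-u j) 1 := by
    ext a
    rcases a with a | a
    · simp [Finset.sum_apply]
    · simp [Finset.sum_apply, hc]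
  rw [this, map_sum]
  simp

/-- A row with sum one is an affine combination of unit vectors, with coefficients of any sign.
Expanding one row at a time reduces to one-hot matrices; S is the set of rows still to be expanded.
-/
theorem det_eq_zero_of_rowSum {M : Matrix (Fin n) (Fin k) ℝ}
    (h : ∀ σ : Fin n → Fin k, ((onehot σ)ᵀ * M).det = 0) {C : Matrix (Fin n) (Fin k) ℝ}
    (hC : ∀ i, ∑ c, C i c = 1) : (Cᵀ * M).det = 0 := by
  have key : ∀ (S : Finset (Fin n)) (C : Matrix (Fin n) (Fin k) ℝ), (∀ i, ∑ c, C i c = 1) →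
      (∀ i ∉ S, ∃ c, C i = Pi.single c 1) → (Cᵀ * M).det = 0 := by
    intro S
    induction S using Finset.induction_on with
    | empty =>
      intro C _ hS
      choose σ hσ using fun i => hS i (Finset.notMem_empty i)
      have : C = onehot σ := by ext i c; rw [hσ]; rfl
      rw [this, h]
    | insert i S _ ih =>
      intro C hC hS
      rw [← updateRow_eq_self C i, transpose_updateRow_mul]
      have hrow : C i = ∑ c, C i c • (Pi.single c 1 : Fin k → ℝ) := by
        ext a; simp [Finset.sum_apply, Pi.single_apply]
      rw [hrow, det_add_vecMulVec_sum _ _ _ (hC i)]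
      refine Finset.sum_eq_zero fun c _ => ?_
      rw [← transpose_updateRow_mul, ih, mul_zero]
      · intro j
        by_cases hj : j = i
        · subst hj; simp [Pi.single_apply]
        · rw [updateRow_ne hj, hC]
      · intro j hj
        by_cases hji : j = i
        · subst hji; exact ⟨c, by simp⟩
        · rw [updateRow_ne hji]; exact hS j (by simp [hji, hj])
  exact key Finset.univ C hC fun i hi => absurd (Finset.mem_univ i) hi

variable {M : Matrix (Fin n) (Fin k) ℝ}

theorem eq_zero_of_dotProduct (hM : LinearIndependent ℝ M.col) {v : Fin k → ℝ}
    (hv : ∀ i, M i ⬝ᵥ v = 0) : v = 0 := by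
  refine (mulVec_injective_iff.2 hM) ?_
  rw [mulVec_zero]
  exact funext hv

/-- Otherwise the determinant vanishes for every C with row sums one. Take C = M * B with B
invertible and B 1 = b: its row sums are M b = 1, yet det (Bᵀ Mᵀ M) is nonzero because the Gram
matrix of independent columns is invertible. -/
theorem exists_det_ne_zero (hM : LinearIndependent ℝ M.col) {b : Fin k → ℝ}
    (hb : M *ᵥ b = 1) : ∃ σ : Fin n → Fin k, ((onehot σ)ᵀ * M).det ≠ 0 := by
  -- With no columns, M b = 1 forces n = 0, and the empty determinant is 1.
  rcases Nat.eq_zero_or_pos k with rfl | hk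
  · have hn : ∀ i : Fin n, False := fun i => by
      have := congrFun hb i
      simp [mulVec, dotProduct] at this
    exact ⟨fun i => (hn i).elim, by rw [det_fin_zero]; exact one_ne_zero⟩
  by_contra! h
  have hb0 : b ≠ 0 := by
    rintro rfl
    rcases Nat.eq_zero_or_pos n with rfl | hn
    · exact hM.ne_zero ⟨0, hk⟩ (Subsingleton.elim _ _)
    · have := congrFun hb ⟨0, hn⟩
      simp at this
  have h10 : (1 : Fin k → ℝ) ≠ 0 := fun h => one_ne_zero (congrFun h ⟨0, hk⟩)
  -- Any nonzero vector is carried to any other one by an invertible map.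
  obtain ⟨e, he⟩ := SeparatingDual.exists_continuousLinearEquiv_apply_eq (R := ℝ) h10 hb0
  let B := LinearMap.toMatrix' (e.toLinearEquiv : (Fin k → ℝ) →ₗ[ℝ] (Fin k → ℝ))
  have hB1 : B *ᵥ 1 = b := by rw [← toLin'_apply, toLin'_toMatrix']; exact he
  have hBdet : B.det ≠ 0 := by
    rw [LinearMap.det_toMatrix']
    exact (LinearEquiv.isUnit_det' e.toLinearEquiv).ne_zero
  have hG : (Mᵀ * M).det ≠ 0 := by
    rw [← isUnit_iff_ne_zero, ← isUnit_iff_isUnit_det, ← mulVec_injective_iff_isUnit]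
    have hker := ker_mulVecLin_transpose_mul_self M
    have hinj : LinearMap.ker M.mulVecLin = ⊥ :=
      LinearMap.ker_eq_bot.2 (mulVec_injective_iff.2 hM)
    rw [hinj] at hker
    exact LinearMap.ker_eq_bot.1 hker
  have hrow : ∀ i, ∑ c, (M * B) i c = 1 := by
    intro i
    have : ((M * B) *ᵥ 1) i = 1 := by rw [← mulVec_mulVec, hB1, hb]; rfl
    simpa [mulVec, dotProduct] using this
  have := det_eq_zero_of_rowSum h hrow
  rw [transpose_mul, Matrix.mul_assoc, det_mul, det_transpose] at this
  exact mul_ne_zero hBdet hG this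

/-- Exchanging two classes exchanges two rows. Hence the maximum is nonnegative as soon as there are
two classes. -/
theorem det_onehot_swap (σ : Fin n → Fin k) {c c' : Fin k} (h : c ≠ c') :
    ((onehot fun i => Equiv.swap c c' (σ i))ᵀ * M).det = -((onehot σ)ᵀ * M).det := by
  have : (onehot fun i => Equiv.swap c c' (σ i))ᵀ * M =
      ((onehot σ)ᵀ * M).submatrix (Equiv.swap c c') id := by
    ext a b
    simp only [mul_apply, submatrix_apply, transpose_apply, onehot_apply, id]
    refine Finset.sum_congr rfl fun i _ => ?_
    have : a = Equiv.swap c c' (σ i) ↔ Equiv.swap c c' a = σ i := by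
      rw [← Equiv.symm_apply_eq, Equiv.symm_swap]
    simp only [this]
  rw [this, det_permute, Equiv.Perm.sign_swap h]
  simp

/-- Matrix determinant lemma, applied to the rank-one change caused by moving row i. -/
theorem det_onehot_update (σ : Fin n → Fin k) (hσ : ((onehot σ)ᵀ * M).det ≠ 0) (i : Fin n)
    (c : Fin k) :
    ((onehot (Function.update σ i c))ᵀ * M).det = ((onehot σ)ᵀ * M).det *
      (1 + ((M * ((onehot σ)ᵀ * M)⁻¹) i c - (M * ((onehot σ)ᵀ * M)⁻¹) i (σ i))) := by
  have h1 : onehot (Function.update σ i c) = (onehot σ).updateRow i (Pi.single c 1) := by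
    ext j a
    by_cases hj : j = i
    · subst hj; simp [onehot]
    · simp [onehot, hj]
  have h2 : onehot σ = (onehot σ).updateRow i (Pi.single (σ i) 1) := by
    ext j a
    by_cases hj : j = i
    · subst hj; simp [onehot]
    · simp [hj]
  have h3 : (onehot (Function.update σ i c))ᵀ * M = (onehot σ)ᵀ * M +
      replicateCol Unit (Pi.single c 1 - Pi.single (σ i) 1 : Fin k → ℝ) *
        replicateRow Unit (M i) := by
    have h4 := transpose_updateRow_mul (onehot σ) M i (Pi.single (σ i) 1)
    rw [← h2] at h4
    rw [h1, transpose_updateRow_mul, h4, add_assoc]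
    congr 1
    rw [← vecMulVec_eq, ← add_vecMulVec]
    simp
  rw [h3, det_add_replicateCol_mul_replicateRow (isUnit_iff_ne_zero.2 hσ)]
  congr 1
  rw [det_unique, Matrix.add_apply]
  simp only [one_apply_eq]
  congr 1
  rw [mul_apply, mul_apply, mul_apply, ← Finset.sum_sub_distrib]
  set Y := ((onehot σ)ᵀ * M)⁻¹
  have : ∀ x, (replicateRow Unit (M i) * Y) default x = (M * Y) i x := fun x => by
    simp [mul_apply]
  simp only [this, replicateCol_apply, Pi.sub_apply, mul_sub, Finset.sum_sub_distrib]
  simp [Pi.single_apply, mul_apply]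

/-- Some maximizer of the determinant is the unique linear partition of a generic matrix. -/
theorem exists_separable_maximizer (hM : LinearIndependent ℝ M.col) {b : Fin k → ℝ}
    (hb : M *ᵥ b = 1) :
    ∃ (σ : Fin n → Fin k) (D : Matrix (Fin k) (Fin k) ℝ), ((onehot σ)ᵀ * M).det ≠ 0 ∧
      (∀ τ : Fin n → Fin k, ((onehot τ)ᵀ * M).det ≤ ((onehot σ)ᵀ * M).det) ∧
      (∀ i c c', c ≠ c' → (M * D) i c ≠ (M * D) i c') ∧
      ∀ i c, c ≠ σ i → (M * D) i c < (M * D) i (σ i) := by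
  obtain ⟨σ₀, hσ₀⟩ := exists_det_ne_zero hM hb
  obtain ⟨σ₁, -, hσ₁⟩ := Finset.exists_max_image (Finset.univ : Finset (Fin n → Fin k))
    (fun σ => ((onehot σ)ᵀ * M).det) ⟨σ₀, Finset.mem_univ _⟩
  -- Among the maximizers, take one with the largest sum of class indices; ties are then always won
  -- by the larger index.
  obtain ⟨σ, hσ, hmax⟩ := Finset.exists_max_image
    (Finset.univ.filter fun σ : Fin n → Fin k =>
      ((onehot σ)ᵀ * M).det = ((onehot σ₁)ᵀ * M).det) (fun σ => ∑ i, (σ i : ℕ))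
    ⟨σ₁, by simp⟩
  simp only [Finset.mem_filter, Finset.mem_univ, true_and] at hσ hmax
  have hdmax : ∀ τ : Fin n → Fin k, ((onehot τ)ᵀ * M).det ≤ ((onehot σ)ᵀ * M).det := fun τ => by
    rw [hσ]; exact hσ₁ τ (Finset.mem_univ _)
  have hnn : ∀ c c' : Fin k, c ≠ c' → 0 ≤ ((onehot σ)ᵀ * M).det := fun c c' hcc => by
    have := hdmax fun i => Equiv.swap c c' (σ i)
    rw [det_onehot_swap σ hcc] at this
    linarith
  -- If σ differs from σ₀ there are two classes, and σ₀ or a swap of it has positive determinant.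
  -- The case σ = σ₀ also covers k = 1, where the maximum may be negative.
  have hne : ((onehot σ)ᵀ * M).det ≠ 0 := by
    by_cases hσσ : σ = σ₀
    · rw [hσσ]; exact hσ₀
    · obtain ⟨i, hi⟩ := Function.ne_iff.1 hσσ
      intro h0
      have h1 := hdmax σ₀
      have h2 := hdmax fun j => Equiv.swap (σ i) (σ₀ i) (σ₀ j)
      rw [det_onehot_swap σ₀ hi] at h2
      rw [h0] at h1 h2
      exact hσ₀ (le_antisymm h1 (by linarith))
  set Y := ((onehot σ)ᵀ * M)⁻¹ with hY
  have hle : ∀ i c, c ≠ σ i → (M * Y) i c < (M * Y) i (σ i) ∨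
      (M * Y) i c = (M * Y) i (σ i) ∧ c < σ i := by
    intro i c hc
    have hpos := lt_of_le_of_ne (hnn c (σ i) hc) hne.symm
    have hup := det_onehot_update σ hne i c
    have h1 : (M * Y) i c ≤ (M * Y) i (σ i) := by
      have h2 := hdmax (Function.update σ i c)
      rw [hup] at h2
      have := (mul_le_iff_le_one_right hpos).1 h2
      linarith
    rcases h1.lt_or_eq with h1 | h1
    · exact Or.inl h1
    · refine Or.inr ⟨h1, lt_of_le_of_ne ?_ hc⟩
      rw [← hY, h1, sub_self, add_zero, mul_one] at hup
      have h2 := hmax _ (hup.trans hσ)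
      rw [← Finset.add_sum_erase _ _ (Finset.mem_univ i),
        ← Finset.add_sum_erase Finset.univ (fun j => (σ j : ℕ)) (Finset.mem_univ i)] at h2
      have h3 : ∑ x ∈ Finset.univ.erase i, (Function.update σ i c x : ℕ) =
          ∑ x ∈ Finset.univ.erase i, (σ x : ℕ) := Finset.sum_congr rfl fun x hx => by
        rw [Function.update_of_ne (Finset.ne_of_mem_erase hx)]
      rw [h3, Function.update_self] at h2
      exact Fin.le_def.2 (by omega)
  -- A small ε preserves all strict inequalities; on ties the term ε * c decides.
  have hev : ∀ᶠ ε : ℝ in nhdsWithin 0 (Set.Ioi 0), ∀ i c c', (M * Y) i c < (M * Y) i c' →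
      (M * Y) i c + ε * (c : ℕ) < (M * Y) i c' + ε * (c' : ℕ) := by
    refine Filter.Eventually.filter_mono nhdsWithin_le_nhds ?_
    refine Filter.eventually_all.2 fun i => Filter.eventually_all.2 fun c =>
      Filter.eventually_all.2 fun c' => ?_
    by_cases h : (M * Y) i c < (M * Y) i c'
    · have hcont : Continuous fun ε : ℝ =>
          (M * Y) i c' + ε * (c' : ℕ) - ((M * Y) i c + ε * (c : ℕ)) := by fun_prop
      have h0 : 0 < (M * Y) i c' + (0 : ℝ) * (c' : ℕ) - ((M * Y) i c + (0 : ℝ) * (c : ℕ)) := by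
        linarith
      exact (hcont.continuousAt.eventually (lt_mem_nhds h0)).mono fun ε hε _ => sub_pos.1 hε
    · exact Filter.Eventually.of_forall fun _ h' => absurd h' h
  obtain ⟨ε, hε, hpos⟩ := (hev.and self_mem_nhdsWithin).exists
  have hpos : 0 < ε := hpos
  -- As M b = 1, adding the outer product of b and (ε * c)_c to Y adds ε * c to each entry of column
  -- c of M * Y.
  have hMD : ∀ i c, (M * (Y + vecMulVec b fun c : Fin k => ε * (c : ℕ))) i c =
      (M * Y) i c + ε * (c : ℕ) := by
    intro i c
    rw [Matrix.mul_add, mul_vecMulVec, hb, Matrix.add_apply, vecMulVec_apply, Pi.one_apply,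
      one_mul]
  have hlex : ∀ i c c', (M * Y) i c = (M * Y) i c' → c < c' →
      (M * Y) i c + ε * (c : ℕ) < (M * Y) i c' + ε * (c' : ℕ) := by
    intro i c c' h hlt
    rw [h]
    have : ((c : ℕ) : ℝ) < (c' : ℕ) := by exact_mod_cast hlt
    have := mul_lt_mul_of_pos_left this hpos
    linarith
  refine ⟨σ, Y + vecMulVec b fun c : Fin k => ε * (c : ℕ), hne, hdmax, fun i c c' hcc => ?_,
    fun i c hc => ?_⟩
  · rw [hMD, hMD]
    rcases lt_trichotomy ((M * Y) i c) ((M * Y) i c') with h | h | h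
    · exact (hε _ _ _ h).ne
    · rcases lt_or_gt_of_ne hcc with h' | h'
      · exact (hlex _ _ _ h h').ne
      · exact (hlex _ _ _ h.symm h').ne'
    · exact (hε _ _ _ h).ne'
  · rw [hMD, hMD]
    rcases hle i c hc with h | ⟨h, h'⟩
    · exact hε _ _ _ h
    · exact hlex _ _ _ h h'

/-- The value at `v` of the signed sum of the cross products of the vectors `a j l`. -/
noncomputable def score (a : Fin k → Fin k → Fin k → ℝ) (s : Fin k → ℝ) (v : Fin k → ℝ) : ℝ :=
  ∑ j, s j * (of fun l : Fin k => if (l : ℕ) + 1 = k then v else a j l).det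

/-- Some maximizer of the determinant is found from the signs of scores. -/
theorem exists_score_maximizer (hM : LinearIndependent ℝ M.col) {b : Fin k → ℝ}
    (hb : M *ᵥ b = 1) :
    ∃ (σ : Fin n → Fin k) (f : Fin k → Fin k → Fin k → Fin k → Fin n)
      (s : Fin k → Fin k → Fin k → ℝ), ((onehot σ)ᵀ * M).det ≠ 0 ∧
      (∀ τ : Fin n → Fin k, ((onehot τ)ᵀ * M).det ≤ ((onehot σ)ᵀ * M).det) ∧
      (∀ c c' j, s c c' j = 1 ∨ s c c' j = -1) ∧
      ∀ i c c', c ≠ c' →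
        (c = σ i → 0 < score (fun j l => M (f c c' j l)) (s c c') (M i)) ∧
        (c' = σ i → ¬ 0 < score (fun j l => M (f c c' j l)) (s c c') (M i)) := by
  obtain ⟨σ, D, h1, h2, h3, h4⟩ := exists_separable_maximizer hM hb
  -- The normal vector is the difference of columns c and c' of D; it meets no row of M since M * D
  -- has no ties. For c = c' the data are fillers.
  have key : ∀ c c' : Fin k, ∃ (f : Fin k → Fin k → Fin n) (s : Fin k → ℝ),
      (∀ j, s j = 1 ∨ s j = -1) ∧ (c ≠ c' → ∀ i, 0 < (M * D) i c - (M * D) i c' ↔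
        0 < score (fun j l => M (f j l)) s (M i)) := by
    intro c c'
    obtain rfl | ⟨m, rfl⟩ : k = 0 ∨ ∃ m, k = m + 1 := by cases k <;> simp
    · exact c.elim0
    have hw : ∀ i, M i ⬝ᵥ (fun r => D r c - D r c') = (M * D) i c - (M * D) i c' := by
      intro i
      simp [mul_apply, dotProduct, mul_sub, Finset.sum_sub_distrib]
    by_cases hcc : c = c'
    · have hn : 0 < n := by
        rcases Nat.eq_zero_or_pos n with rfl | hn
        · exact absurd (Subsingleton.elim _ _) (hM.ne_zero c)
        · exact hn
      exact ⟨fun _ _ => ⟨0, hn⟩, fun _ => 1, fun _ => Or.inl rfl, fun h => absurd hcc h⟩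
    · obtain ⟨f, s, hs, hf⟩ := exists_crossProducts (a := fun i => M i)
        (w := fun r => D r c - D r c') (fun v hv => eq_zero_of_dotProduct hM hv)
        (fun i => by rw [hw]; exact sub_ne_zero.2 (h3 i c c' hcc))
      refine ⟨f, s, hs, fun _ i => ?_⟩
      rw [← hw, hf, score]
      have : ∀ j, (of fun l => M (f j l)).updateRow (Fin.last m) (M i) =
          of fun l : Fin (m + 1) => if (l : ℕ) + 1 = m + 1 then M i else M (f j l) := by
        intro j
        ext l r
        by_cases hl : l = Fin.last m
        · subst hl; simp
        · have : (l : ℕ) ≠ m := fun h => hl (Fin.ext h)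
          simp [hl, this]
      simp only [this]
  choose f s hs hf using key
  refine ⟨σ, f, s, h1, h2, hs, fun i c c' hcc => ⟨fun h => ?_, fun h => ?_⟩⟩
  · rw [← hf c c' hcc i, sub_pos, h]
    exact h4 i c' (h ▸ hcc.symm)
  · rw [← hf c c' hcc i, sub_pos, h, not_lt]
    exact (h4 i c (h ▸ hcc)).le

end Assignments

/-! ### Column choices and the rank. -/

section Columns

variable {n d k : ℕ} (A : Matrix (Fin n) (Fin d) ℝ)

theorem augment_last (i : Fin n) : augment A i (Fin.last d) = 1 := by
  simp [augment]

variable {A}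

theorem span_picked_le (L : Fin k → Fin (d + 1)) :
    Submodule.span ℝ (Set.range (picked A L).col) ≤
      Submodule.span ℝ (Set.range (augment A).col) := by
  rw [Submodule.span_le]
  rintro _ ⟨j, rfl⟩
  exact Submodule.subset_span ⟨L j, rfl⟩

theorem le_rank_of_linearIndependent {L : Fin k → Fin (d + 1)}
    (h : LinearIndependent ℝ (picked A L).col) : k ≤ (augment A).rank := by
  rw [rank_eq_finrank_span_cols, ← Fintype.card_fin k, ← finrank_span_eq_card h]
  exact Submodule.finrank_mono (span_picked_le L)

/-- Rank-many independent columns span the whole column space, which contains the appended column of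
ones. -/
theorem IsColumnChoice.exists_mulVec_eq_one {L : Fin k → Fin (d + 1)} (h : IsColumnChoice A L) :
    ∃ b, picked A L *ᵥ b = 1 := by
  have heq : Submodule.span ℝ (Set.range (picked A L).col) =
      Submodule.span ℝ (Set.range (augment A).col) := by
    refine Submodule.eq_of_le_of_finrank_eq (span_picked_le L) ?_
    rw [finrank_span_eq_card h.2, Fintype.card_fin, ← rank_eq_finrank_span_cols, h.1]
  have h1 : (1 : Fin n → ℝ) ∈ Submodule.span ℝ (Set.range (picked A L).col) := by
    rw [heq]
    exact Submodule.subset_span ⟨Fin.last d, funext fun i => augment_last A i⟩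
  rw [← range_mulVecLin] at h1
  exact h1

theorem exists_isColumnChoice :
    ∃ L : Fin (augment A).rank → Fin (d + 1), IsColumnChoice A L := by
  obtain ⟨b, hb, hspan, hli⟩ := exists_linearIndependent ℝ (Set.range (augment A).col)
  have hfin : b.Finite := (Set.finite_range _).subset hb
  have := hfin.fintype
  have hcard : (augment A).rank = Fintype.card b := by
    rw [rank_eq_finrank_span_cols, ← hspan, finrank_span_set_eq_card hli, Set.toFinset_card]
  let e := Fintype.equivFinOfCardEq hcard.symm
  choose g hg using fun x : b => hb x.2
  refine ⟨fun j => g (e.symm j), rfl, ?_⟩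
  have : (picked A fun j => g (e.symm j)).col = fun j => (e.symm j : Fin n → ℝ) := by
    funext j
    rw [← hg]
    rfl
  rw [this]
  exact hli.comp _ e.symm.injective

/-- This makes a rank test superfluous: dependent columns never yield a nonzero determinant. -/
theorem linearIndependent_of_det_ne_zero {C M : Matrix (Fin n) (Fin k) ℝ}
    (h : (Cᵀ * M).det ≠ 0) : LinearIndependent ℝ M.col := by
  rw [← mulVec_injective_iff]
  intro x y hxy
  rw [← isUnit_iff_ne_zero, ← isUnit_iff_isUnit_det, ← mulVec_injective_iff_isUnit] at h
  apply h
  rw [← mulVec_mulVec, ← mulVec_mulVec]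
  exact congrArg _ hxy

end Columns

/-! ## Expressions for determinants and scores -/

/-- `e * m` for a constant `m`. -/
def NExpr.times (e : NExpr) : ℕ → NExpr
  | 0 => .const 0
  | m + 1 => .add (e.times m) e

@[simp] theorem NExpr.eval_times (s : State) (e : NExpr) (m : ℕ) :
    (e.times m).eval s = e.eval s * m := by
  induction m with
  | zero => rfl
  | succ m ih => rw [times, eval, ih, Nat.mul_succ]

namespace RExpr

section
variable {α : Type} [Fintype α]

noncomputable def sum (f : α → RExpr) : RExpr :=
  (Finset.univ.toList.map f).foldr RExpr.add (RExpr.const 0)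

noncomputable def prod (f : α → RExpr) : RExpr :=
  (Finset.univ.toList.map f).foldr RExpr.mul (RExpr.const 1)

theorem eval_sum (s : State) (f : α → RExpr) : (sum f).eval s = ∑ a, (f a).eval s := by
  have h : ∀ l : List α, ((l.map f).foldr RExpr.add (RExpr.const 0)).eval s =
      (l.map fun a => (f a).eval s).sum := by
    intro l
    induction l with
    | nil => simp [eval]
    | cons a l ih => simp [eval, ih]
  rw [sum, h, Finset.sum_map_toList]

theorem eval_prod (s : State) (f : α → RExpr) : (prod f).eval s = ∏ a, (f a).eval s := by
  have h : ∀ l : List α, ((l.map f).foldr RExpr.mul (RExpr.const 1)).eval s =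
      (l.map fun a => (f a).eval s).prod := by
    intro l
    induction l with
    | nil => simp [eval]
    | cons a l ih => simp [eval, ih]
  rw [prod, h, Finset.prod_map_toList]

end

variable {k : ℕ}

/-- The Leibniz expansion has k! terms, a constant for fixed d. -/
noncomputable def det (X : Fin k → Fin k → RExpr) : RExpr :=
  sum fun σ : Equiv.Perm (Fin k) => mul (const ((Equiv.Perm.sign σ : ℤ) : ℚ)) (prod fun i => X (σ i) i)

theorem eval_det (s : State) (X : Fin k → Fin k → RExpr) :
    (det X).eval s = (of fun i j => (X i j).eval s).det := by
  rw [det, eval_sum, det_apply]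
  refine Finset.sum_congr rfl fun σ _ => ?_
  rw [eval, eval_prod, eval, Units.smul_def, zsmul_eq_mul]
  simp

/-- An entry of the inverse of a matrix of expressions, given an expression for its determinant. -/
noncomputable def inv (X : Fin k → Fin k → RExpr) (e : RExpr) (a b : Fin k) : RExpr :=
  div (det fun i j => if i = b then const (if j = a then 1 else 0) else X i j) e

/-- Cramer's rule. It also holds for singular Y, where both sides are zero by the conventions for
division and inverse. -/
theorem eval_inv {s : State} {X : Fin k → Fin k → RExpr} {e : RExpr} {Y : Matrix (Fin k) (Fin k) ℝ}
    (hY : ∀ i j, (X i j).eval s = Y i j) (he : e.eval s = Y.det) (a b : Fin k) :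
    (inv X e a b).eval s = Y⁻¹ a b := by
  rw [inv, eval, eval_det, he, Matrix.inv_def, Matrix.smul_apply, adjugate_apply,
    Ring.inverse_eq_inv', smul_eq_mul, div_eq_inv_mul]
  congr 2
  ext i j
  by_cases hi : i = b
  · subst hi
    by_cases hj : j = a <;> simp [hj, eval]
  · simp [hi, hY]

end RExpr

/-! ### Encoding of candidates in the loop counters. -/

section Score

variable {d k : ℕ} (L : Fin k → Fin (d + 1))

/-- Row `i` of the matrix `Ã` in terms of the real array that holds the input. -/
noncomputable def cellRow (R : ℕ → ℝ) (i : ℕ) : Fin k → ℝ :=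
  fun j => if (L j : ℕ) < d then R (i * d + L j) else 1

theorem cellRow_inputState {n : ℕ} (A : Matrix (Fin n) (Fin d) ℝ) (i : Fin n) :
    cellRow L ((inputState A).real 0) i = picked A L i := by
  funext j
  rw [cellRow, picked, submatrix_apply, augment]
  simp only [of_apply, id]
  by_cases h : (L j : ℕ) < d
  · rw [if_pos h]
    have hd : 0 < d := by omega
    have hlt : (i : ℕ) * d + L j < n * d := by
      calc (i : ℕ) * d + L j < i * d + d := by omega
        _ = (i + 1) * d := by ring
        _ ≤ n * d := Nat.mul_le_mul_right d i.2
    have hL : L j = Fin.castSucc ⟨L j, h⟩ := rfl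
    rw [hL, Fin.snoc_castSucc]
    simp only [inputState, if_true, dif_pos hlt, Fin.val_castSucc]
    congr 1
    · ext
      simp only [Fin.coe_divNat]
      rw [Nat.mul_comm, Nat.mul_add_div hd, Nat.div_eq_of_lt h, add_zero]
    · ext
      simp only [Fin.coe_modNat]
      rw [Nat.mul_comm, Nat.mul_add_mod, Nat.mod_eq_of_lt h]
  · rw [if_neg h]
    have hL : L j = Fin.last d := Fin.ext (by have := (L j).2; simp; omega)
    rw [hL, Fin.snoc_last]

/-- The entry `(I, j)` of `Ã`, as an expression. -/
def entry (I : NExpr) (j : Fin k) : RExpr :=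
  if (L j : ℕ) < d then .get 0 (.add (I.times d) (.const (L j))) else .const 1

theorem eval_entry (s : State) (I : NExpr) (j : Fin k) :
    (entry L I j).eval s = cellRow L (s.real 0) (I.eval s) j := by
  rw [entry, cellRow]
  split_ifs <;> simp [RExpr.eval, NExpr.eval]

/-- The number of loop counters that describe a candidate. -/
def slots (k : ℕ) : ℕ := Fintype.card (Fin k × Fin k × Fin k × Fin k)

/-- The counter in which slot `l` of ray `j` of the score of `c` against `c'` is held. -/
noncomputable def slot (c c' j l : Fin k) : ℕ :=
  Fintype.equivFin (Fin k × Fin k × Fin k × Fin k) (c, c', j, l)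

theorem slot_lt (c c' j l : Fin k) : slot c c' j l < slots k := Fin.is_lt _

/-- In a score, the row in this slot is replaced by the tested vector, so its counter is free to
select the sign. -/
def lastSlot (j : Fin k) : Fin k := ⟨k - 1, by have := j.2; omega⟩

/-- The score of class `c` against class `c'` at row `i`, for the candidate `x`. -/
noncomputable def candidateScore (R g : ℕ → ℝ) (x : ℕ → ℕ) (i : ℕ) (c c' : Fin k) : ℝ :=
  score (fun j l => cellRow L R (x (slot c c' j l))) (fun j => g (x (slot c c' j (lastSlot j))))
    (cellRow L R i)

/-- The counter `slots k` runs over the rows while a candidate is evaluated, and must not affect the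
scores. -/
theorem candidateScore_congr {R g : ℕ → ℝ} {x y : ℕ → ℕ} (h : ∀ v < slots k, x v = y v) (i : ℕ)
    (c c' : Fin k) : candidateScore L R g x i c c' = candidateScore L R g y i c c' := by
  simp only [candidateScore, h _ (slot_lt _ _ _ _)]

/-- Real array `2` is the table of signs, with 1 in cell `0` and -1 in cell `1`. -/
noncomputable def scoreExpr (I : NExpr) (c c' : Fin k) : RExpr :=
  .sum fun j : Fin k =>
    .mul (.get 2 (.get 4 (.const (slot c c' j (lastSlot j)))))
      (.det fun l r : Fin k => if (l : ℕ) + 1 = k then entry L I r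
        else entry L (.get 4 (.const (slot c c' j l))) r)

theorem eval_scoreExpr (s : State) (I : NExpr) (c c' : Fin k) :
    (scoreExpr L I c c').eval s =
      candidateScore L (s.real 0) (s.real 2) (s.nat 4) (I.eval s) c c' := by
  rw [scoreExpr, RExpr.eval_sum, candidateScore, score]
  refine Finset.sum_congr rfl fun j _ => ?_
  rw [RExpr.eval, RExpr.eval_det]
  congr 2
  ext l r
  by_cases hl : (l : ℕ) + 1 = k <;> simp [hl, eval_entry, NExpr.eval]

/-- The scores of the candidate `x` single out class `c` at row `i`. -/
def Decides (R g : ℕ → ℝ) (x : ℕ → ℕ) (i : ℕ) (c : Fin k) : Prop :=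
  -- The scores for (c, c') and (c', c) use separate slots and need not be opposite, so both are
  -- constrained.
  ∀ c', c ≠ c' → 0 < candidateScore L R g x i c c' ∧ ¬ 0 < candidateScore L R g x i c' c

end Score

/-! ## The program -/

theorem cell_inj {k c c' j j' : ℕ} (hj : j < k) (hj' : j' < k) :
    c * k + j = c' * k + j' ↔ c = c' ∧ j = j' := by
  constructor
  · intro h
    have h1 : (c * k + j) / k = c := by
      rw [Nat.mul_comm, Nat.mul_add_div (by omega), Nat.div_eq_of_lt hj, add_zero]
    have h2 : (c' * k + j') / k = c' := by
      rw [Nat.mul_comm, Nat.mul_add_div (by omega), Nat.div_eq_of_lt hj', add_zero]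
    have h3 : c = c' := by rw [← h1, h, h2]
    subst h3
    exact ⟨rfl, by omega⟩
  · rintro ⟨rfl, rfl⟩; rfl

namespace Code

section

variable {d k : ℕ} (L : Fin k → Fin (d + 1))

/-- The counter of the loops over the rows. -/
def rowIndex (k : ℕ) : NExpr := .get 4 (.const (slots k))

/-- Array `6` records a failed comparison, array `5` the class. -/
noncomputable def classify : Code :=
  seq (setNat 5 (.const 0) (.const 0))
    (unroll fun c : Fin k =>
      seq (setNat 6 (.const 0) (.const 0))
        (seq
          (unroll fun c' : Fin k => if c = c' then skip else
            ite (.realLt (.const 0) (scoreExpr L (rowIndex k) c c')) skip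
              (setNat 6 (.const 0) (.const 1)))
          (ite (.natEq (.get 6 (.const 0)) (.const 0)) (setNat 5 (.const 0) (.const c)) skip)))

/-- Add a row of `Ã` to the row of its class in the matrix `Cᵀ Ã`, held in array `3`. -/
def accumulate : Code :=
  unroll fun j : Fin k =>
    setReal 3 (.add ((NExpr.get 5 (.const 0)).times k) (.const j))
      (.add (.get 3 (.add ((NExpr.get 5 (.const 0)).times k) (.const j)))
        (entry L (rowIndex k) j))

/-- Array `7` keeps the classes of the current candidate, apart from the output array `3`, which is
written only on acceptance. -/
noncomputable def rowStep : Code :=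
  seq (classify L) (seq (setNat 7 (rowIndex k) (.get 5 (.const 0))) (accumulate L))

def clear (k : ℕ) : Code :=
  unroll fun a : Fin k => unroll fun b : Fin k => setReal 3 (.const (a * k + b)) (.const 0)

def writeColumns : Code := unroll fun j : Fin k => setNat 2 (.const j) (.const (L j))

def writeAssignment (k : ℕ) : Code :=
  count (slots k) 0 (unroll fun c : Fin k =>
    ite (.natEq (.get 7 (rowIndex k)) (.const c))
      (setNat 3 (.add ((rowIndex k).times k) (.const c)) (.const 1))
      (setNat 3 (.add ((rowIndex k).times k) (.const c)) (.const 0)))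

noncomputable def writeInverse (k : ℕ) : Code :=
  unroll fun a : Fin k => unroll fun b : Fin k =>
    setReal 1 (.const (a * k + b))
      (.inv (fun i j : Fin k => .get 3 (.const (i * k + j))) (.get 4 (.const 0)) a b)

/-- Record the current candidate as the best one. -/
noncomputable def accept : Code :=
  seq (setReal 5 (.const 0) (.get 4 (.const 0)))
    (seq (setNat 1 (.const 0) (.const k))
      (seq (writeColumns L) (seq (writeAssignment k) (writeInverse k))))

noncomputable def evaluate : Code :=
  seq (clear k) (seq (count (slots k) 0 (rowStep L))
    (setReal 4 (.const 0) (.det fun i j : Fin k => .get 3 (.const (i * k + j)))))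

/-- A zero in cell `0` of real array `5` means that nothing has been accepted. The first nonzero
determinant is accepted even if negative, as the maximum can be negative for k = 1. -/
noncomputable def candidate : Code :=
  seq (evaluate L)
    (ite (.realEq (.get 4 (.const 0)) (.const 0)) skip
      (ite (.realEq (.get 5 (.const 0)) (.const 0)) (accept L)
        (ite (.realLt (.get 5 (.const 0)) (.get 4 (.const 0))) (accept L) skip)))

/-- Search all candidates for the columns `L`. -/
noncomputable def search : Code :=
  seq (setReal 5 (.const 0) (.const 0))
    (seq (setReal 2 (.const 0) (.const 1))
      (seq (setReal 2 (.const 1) (.const (-1))) (nest (candidate L) (slots k))))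

end

/-- Search for all lists of columns, those with more columns last. -/
noncomputable def solve (d : ℕ) : Code :=
  unroll fun k : Fin (d + 2) =>
    each (Finset.univ : Finset (Fin k → Fin (d + 1))).toList fun L => search L

/-! ### Correctness of the building blocks of the program. -/

section

variable {d k : ℕ} {L : Fin k → Fin (d + 1)}

theorem exec_nat {a : ℕ} {p : Code} (hp : p.KeepsNat a) (s : State) :
    (p.exec s).nat a = s.nat a := funext fun i => exec_nat_eq hp s i

theorem exec_real {a : ℕ} {p : Code} (hp : p.KeepsReal a) (s : State) :
    (p.exec s).real a = s.real a := funext fun i => exec_real_eq hp s i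

theorem classify_keepsNat {a : ℕ} (h5 : a ≠ 5) (h6 : a ≠ 6) : (classify L).KeepsNat a := by
  simp only [classify, KeepsNat, unroll_keepsNat, and_true]
  refine ⟨h5, fun c => ⟨h6, fun c' => ?_, h5⟩⟩
  split_ifs <;> simp [KeepsNat, h6]

theorem classify_keepsReal {a : ℕ} : (classify L).KeepsReal a := by
  simp only [classify, KeepsReal, unroll_keepsReal, and_true, true_and]
  intro c c'
  split_ifs <;> simp [KeepsReal]

theorem classify_wf : (classify L).WF := by
  simp only [classify, WF, unroll_wf]
  refine ⟨by decide, fun c => ⟨by decide, fun c' => ?_, by decide, trivial⟩⟩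
  split_ifs <;> simp [WF]

theorem classify_uses {v : ℕ} : ¬ (classify L).Uses v := by
  simp only [classify, Uses, unroll_uses, false_or, or_false, not_exists]
  intro c c'
  split_ifs <;> simp [Uses]

theorem rowStep_wf : (rowStep L).WF := by
  simp [rowStep, WF, classify_wf, accumulate]

theorem rowStep_uses {v : ℕ} : ¬ (rowStep L).Uses v := by
  simp [rowStep, Uses, classify_uses, accumulate]

theorem candidate_wf : (candidate L).WF := by
  simp [candidate, evaluate, accept, clear, writeColumns, writeAssignment, writeInverse, WF,
    rowStep_wf, rowStep_uses, Uses]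

/-- The only loop counter is `slots k`, so the counters below it are free for the enclosing nest. -/
theorem candidate_uses {v : ℕ} (hv : v < slots k) : ¬ (candidate L).Uses v := by
  simp only [candidate, evaluate, accept, clear, writeColumns, writeAssignment, writeInverse, Uses,
    rowStep_uses, unroll_uses, hv.ne, or_false, exists_false, not_false_eq_true]

theorem search_wf : (search L).WF := by
  simp [search, WF, nest_wf (candidate_wf (L := L)) fun v hv => candidate_uses hv]

theorem solve_wf : (solve d).WF := by
  simp [solve, each_wf, search_wf]

/-- Class 0 is the default, which gives a valid class even for a meaningless candidate. If the
scores single out c, then c passes all its comparisons and every other class fails against c. -/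
theorem classify_spec (s : State) :
    (0 < k → ((classify L).exec s).nat 5 0 < k) ∧
      ∀ c, Decides L (s.real 0) (s.real 2) (s.nat 4) (s.nat 4 (slots k)) c →
        ((classify L).exec s).nat 5 0 = c := by
  rw [classify, exec]
  have h := unroll_induct (p := fun c : Fin k =>
      seq (setNat 6 (.const 0) (.const 0))
        (seq
          (unroll fun c' : Fin k => if c = c' then skip else
            ite (.realLt (.const 0) (scoreExpr L (rowIndex k) c c')) skip
              (setNat 6 (.const 0) (.const 1)))
          (ite (.natEq (.get 6 (.const 0)) (.const 0)) (setNat 5 (.const 0) (.const c)) skip)))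
    (s := (setNat 5 (.const 0) (.const 0)).exec s)
    (fun m s' => s'.real = s.real ∧ s'.nat 4 = s.nat 4 ∧ (0 < k → s'.nat 5 0 < k) ∧
      ∀ c : Fin k, Decides L (s.real 0) (s.real 2) (s.nat 4) (s.nat 4 (slots k)) c →
        (c : ℕ) < m → s'.nat 5 0 = c)
    ⟨rfl, funext fun i => by simp [exec], by simp [exec, NExpr.eval], by simp⟩ ?_
  · exact ⟨h.2.2.1, fun c hc => h.2.2.2 c hc c.2⟩
  rintro c s₁ ⟨h1, h2, h3, h4⟩
  simp only [exec_seq]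
  have hflag := unroll_induct (p := fun c' : Fin k => if c = c' then skip else
        ite (.realLt (.const 0) (scoreExpr L (rowIndex k) c c')) skip
          (setNat 6 (.const 0) (.const 1)))
    (s := (setNat 6 (.const 0) (.const 0)).exec s₁)
    (fun m s' => s'.real = s.real ∧ s'.nat 4 = s.nat 4 ∧ s'.nat 5 = s₁.nat 5 ∧
      (s'.nat 6 0 = 0 ↔ ∀ c' : Fin k, (c' : ℕ) < m → c ≠ c' →
        0 < candidateScore L (s.real 0) (s.real 2) (s.nat 4) (s.nat 4 (slots k)) c c'))
    ⟨h1, by rw [← h2]; funext i; simp [exec], by funext i; simp [exec], by simp [exec, NExpr.eval]⟩ ?_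
  · generalize (unroll _).exec ((setNat 6 _ _).exec s₁) = s₂ at hflag
    obtain ⟨f1, f2, f3, f4⟩ := hflag
    by_cases hz : s₂.nat 6 0 = 0
    · rw [exec_ite_pos (by simpa [Test.holds, NExpr.eval] using hz)]
      refine ⟨f1, by rw [← f2]; funext i; simp [exec], fun _ => by simp [exec, NExpr.eval],
        fun c₀ hc₀ hlt => ?_⟩
      by_cases hcc : c = c₀
      · simp [exec, NExpr.eval, hcc]
      -- A class other than c₀ cannot pass, since its comparison with c₀ fails.
      · exact absurd (f4.1 hz c₀ c₀.2 hcc) (hc₀ c (Ne.symm hcc)).2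
    · rw [exec_ite_neg (by simpa [Test.holds, NExpr.eval] using hz), exec]
      refine ⟨f1, f2, by rw [f3]; exact h3, fun c₀ hc₀ hlt => ?_⟩
      by_cases hcc : c₀ = c
      · subst hcc
        exact absurd (f4.2 fun c' _ hne => (hc₀ c' hne).1) hz
      · rw [f3]
        exact h4 c₀ hc₀ (lt_of_le_of_ne (Nat.lt_succ_iff.1 hlt) fun h => hcc (Fin.ext h))
  · rintro c' s₂ ⟨f1, f2, f3, f4⟩
    by_cases hcc : c = c'
    · rw [if_pos hcc]
      refine ⟨f1, f2, f3, f4.trans ⟨fun h c₁ hlt hne => h c₁ ?_ hne, fun h c₁ hlt hne =>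
        h c₁ (Nat.lt_succ_of_lt hlt) hne⟩⟩
      exact lt_of_le_of_ne (Nat.lt_succ_iff.1 hlt) fun h => hne (hcc.trans (Fin.ext h.symm))
    · rw [if_neg hcc]
      have htest : (Test.realLt (.const 0) (scoreExpr L (rowIndex k) c c')).holds s₂ ↔
          0 < candidateScore L (s.real 0) (s.real 2) (s.nat 4) (s.nat 4 (slots k)) c c' := by
        rw [Test.holds, eval_scoreExpr, f1, f2]
        simp [RExpr.eval, rowIndex, NExpr.eval, f2]
      by_cases ht : 0 < candidateScore L (s.real 0) (s.real 2) (s.nat 4) (s.nat 4 (slots k)) c c'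
      · rw [exec_ite_pos (htest.2 ht), exec]
        refine ⟨f1, f2, f3, f4.trans ⟨fun h c₁ hlt hne => ?_, fun h c₁ hlt hne =>
          h c₁ (Nat.lt_succ_of_lt hlt) hne⟩⟩
        rcases (Nat.lt_succ_iff.1 hlt).lt_or_eq with h' | h'
        · exact h c₁ h' hne
        · rwa [Fin.ext h']
      · rw [exec_ite_neg fun h => ht (htest.1 h)]
        refine ⟨f1, by rw [← f2]; funext i; simp [exec], by rw [← f3]; funext i; simp [exec], ?_⟩
        simp only [exec, NExpr.eval, State.writeNat_nat, and_self, if_true, one_ne_zero, false_iff]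
        exact fun h => ht (h c' (Nat.lt_succ_self _) hcc)

theorem accumulate_spec (s : State) (c : ℕ) (j : Fin k) :
    ((accumulate L).exec s).real 3 (c * k + j) = s.real 3 (c * k + j) +
      if s.nat 5 0 = c then cellRow L (s.real 0) (s.nat 4 (slots k)) j else 0 := by
  have h := unroll_induct (p := fun j : Fin k =>
      setReal 3 (.add ((NExpr.get 5 (.const 0)).times k) (.const j))
      (.add (.get 3 (.add ((NExpr.get 5 (.const 0)).times k) (.const j)))
        (entry L (rowIndex k) j))) (s := s)
    (fun m s' => s'.nat = s.nat ∧ s'.real 0 = s.real 0 ∧ ∀ j : Fin k,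
      s'.real 3 (c * k + j) = s.real 3 (c * k + j) +
        if s.nat 5 0 = c ∧ (j : ℕ) < m then cellRow L (s.real 0) (s.nat 4 (slots k)) j else 0)
    ⟨rfl, rfl, by simp⟩ ?_
  · have := h.2.2 j
    simpa [accumulate] using this
  · rintro i s₁ ⟨h1, h2, h3⟩
    refine ⟨h1, by rw [← h2]; funext i; simp [exec], fun j => ?_⟩
    simp only [exec, NExpr.eval, NExpr.eval_times, State.writeReal_real, RExpr.eval, eval_entry,
      true_and, h1, h2, rowIndex, cell_inj j.2 i.2]
    by_cases hc : s.nat 5 0 = c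
    · by_cases hj : j = i
      · subst hj
        rw [if_pos ⟨hc.symm, rfl⟩, hc, h3]
        simp [hc]
      · have hj' : (j : ℕ) ≠ i := fun h => hj (Fin.ext h)
        rw [if_neg fun h => hj' h.2, h3]
        have : (j : ℕ) < i + 1 ↔ (j : ℕ) < i := by omega
        simp [this]
    · rw [if_neg fun h => hc h.1.symm, h3]
      simp [hc]

theorem clear_spec (s : State) (a b : Fin k) : ((clear k).exec s).real 3 (a * k + b) = 0 := by
  refine unroll_induct (I := fun m s' => ∀ a : Fin k, (a : ℕ) < m → ∀ b : Fin k,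
    s'.real 3 (a * k + b) = 0) (s := s) (by simp) ?_ a a.2 b
  intro i s₁ h1
  have := unroll_induct (p := fun b : Fin k => setReal 3 (.const (i * k + b)) (.const 0)) (s := s₁)
    (I := fun m s' => (∀ a : Fin k, (a : ℕ) < i → ∀ b : Fin k, s'.real 3 (a * k + b) = 0) ∧
      ∀ b : Fin k, (b : ℕ) < m → s'.real 3 (i * k + b) = 0) ⟨h1, by simp⟩ ?_
  · intro a ha b
    rcases (Nat.lt_succ_iff.1 ha).lt_or_eq with h | h
    · exact this.1 a h b
    · rw [h]; exact this.2 b b.2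
  · rintro j s₂ ⟨h2, h3⟩
    simp only [exec, NExpr.eval, RExpr.eval, State.writeReal_real, true_and, Rat.cast_zero]
    refine ⟨fun a ha b => ?_, fun b hb => ?_⟩
    · split_ifs
      · rfl
      · exact h2 a ha b
    · split_ifs with h
      · rfl
      · refine h3 b (lt_of_le_of_ne (Nat.lt_succ_iff.1 hb) fun hbj => h (by rw [hbj]))

/-- The counters below `slots k` survive each round, so all rows are classified by the same
candidate. -/
theorem rows_spec {n : ℕ} (s : State) (hn : s.nat 0 0 = n)
    (h0 : ∀ a b : Fin k, s.real 3 (a * k + b) = 0) :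
    (∀ i < n, (0 < k → ((count (slots k) 0 (rowStep L)).exec s).nat 7 i < k) ∧
      ∀ c, Decides L (s.real 0) (s.real 2) (s.nat 4) i c →
        ((count (slots k) 0 (rowStep L)).exec s).nat 7 i = c) ∧
    ∀ c j : Fin k, ((count (slots k) 0 (rowStep L)).exec s).real 3 (c * k + j) =
      ∑ i ∈ Finset.range n, if ((count (slots k) 0 (rowStep L)).exec s).nat 7 i = c
        then cellRow L (s.real 0) i j else 0 := by
  simp only [exec, hn, add_zero, State.writeNat_nat, State.writeNat_real]
  have h := rounds_induct (F := (rowStep L).exec) (v := slots k) (s := s) (r := n)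
    (fun m s' => s'.real 0 = s.real 0 ∧ s'.real 2 = s.real 2 ∧
      (∀ v < slots k, s'.nat 4 v = s.nat 4 v) ∧
      (∀ i < m, (0 < k → s'.nat 7 i < k) ∧
        ∀ c, Decides L (s.real 0) (s.real 2) (s.nat 4) i c → s'.nat 7 i = c) ∧
      ∀ c j : Fin k, s'.real 3 (c * k + j) =
        ∑ i ∈ Finset.range m, if s'.nat 7 i = c then cellRow L (s.real 0) i j else 0)
    ⟨rfl, rfl, fun _ _ => rfl, by simp, by simpa using h0⟩ ?_
  · simpa using ⟨h.2.2.2.1, h.2.2.2.2⟩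
  rintro m - s₁ ⟨h1, h2, h3, h4, h5⟩
  set s₂ := s₁.writeNat 4 (slots k) m with hs₂
  have hcount : s₂.nat 4 (slots k) = m := by simp [hs₂]
  have h3' : ∀ v < slots k, s₂.nat 4 v = s.nat 4 v := fun v hv => by
    rw [hs₂, State.writeNat_nat, if_neg (by omega), h3 v hv]
  obtain ⟨c1, c2⟩ := classify_spec (L := L) s₂
  set s₃ := (classify L).exec s₂ with hs₃
  have e4 : s₃.nat 4 = s₂.nat 4 := exec_nat (classify_keepsNat (by decide) (by decide)) _
  have e7 : s₃.nat 7 = s₁.nat 7 := by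
    rw [hs₃, exec_nat (classify_keepsNat (by decide) (by decide))]
    funext i; simp [hs₂]
  have er : ∀ a, s₃.real a = s₁.real a := fun a => exec_real classify_keepsReal _
  have hdec : ∀ i c, Decides L (s.real 0) (s.real 2) (s.nat 4) i c →
      Decides L (s₂.real 0) (s₂.real 2) (s₂.nat 4) i c := by
    intro i c hc c' hne
    have := hc c' hne
    rw [← candidateScore_congr L h3', ← candidateScore_congr L h3', ← h1, ← h2] at this
    exact this
  have hnat7 : ∀ i, ((rowStep L).exec s₂).nat 7 i = if i = m then s₃.nat 5 0 else s₁.nat 7 i := by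
    intro i
    rw [rowStep, exec, exec, exec_nat_eq (by simp [accumulate, KeepsNat]), exec,
      State.writeNat_nat, ← hs₃, e7]
    simp [NExpr.eval, rowIndex, e4, hcount]
  refine ⟨?_, ?_, fun v hv => ?_, fun i hi => ?_, fun c j => ?_⟩
  · rw [exec_real rowStep_wf.keepsReal]; exact h1
  · rw [exec_real (by simp [rowStep, KeepsReal, classify_keepsReal, accumulate])]; exact h2
  · rw [exec_counter rowStep_wf rowStep_uses, h3' v hv]
  · rw [hnat7]
    split_ifs with him
    · subst him
      exact ⟨c1, fun c hc => c2 c (by rw [hcount]; exact hdec _ _ hc)⟩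
    · exact h4 i (by omega)
  · rw [Finset.sum_range_succ, hnat7, if_pos rfl]
    have hsum : ∀ c : ℕ, (∑ i ∈ Finset.range m, if ((rowStep L).exec s₂).nat 7 i = c
        then cellRow L (s.real 0) i j else 0) =
        ∑ i ∈ Finset.range m, if s₁.nat 7 i = c then cellRow L (s.real 0) i j else 0 := fun c =>
      Finset.sum_congr rfl fun i hi => by
        rw [hnat7, if_neg (Finset.mem_range.1 hi).ne]
    rw [hsum, ← h5, rowStep, exec, exec, accumulate_spec, exec, ← hs₃]
    simp [er, h1, e4, hcount]

theorem writeColumns_spec (s : State) (j : Fin k) :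
    ((writeColumns L).exec s).nat 2 j = L j := by
  refine unroll_induct (I := fun m s' => ∀ j : Fin k, (j : ℕ) < m → s'.nat 2 j = L j) (s := s)
    (by simp) ?_ j j.2
  intro i s₁ h1 j hj
  simp only [exec, NExpr.eval, State.writeNat_nat, true_and]
  split_ifs with h
  · rw [Fin.ext h]
  · exact h1 j (by omega)

theorem writeAssignment_spec {n : ℕ} (s : State) (hn : s.nat 0 0 = n) {i : ℕ} (hi : i < n)
    (c : Fin k) : ((writeAssignment k).exec s).nat 3 (i * k + c) =
      if s.nat 7 i = c then 1 else 0 := by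
  simp only [writeAssignment, exec, hn, add_zero, State.writeNat_nat]
  rw [if_neg fun h => absurd h.1 (by decide)]
  refine (rounds_induct (r := n) (fun m s' => s'.nat 7 = s.nat 7 ∧ ∀ i < m, ∀ c : Fin k,
    s'.nat 3 (i * k + c) = if s.nat 7 i = c then 1 else 0) ⟨rfl, by simp⟩ ?_).2 i hi c
  rintro r - s₁ ⟨h1, h2⟩
  have := unroll_induct (p := fun c : Fin k =>
    ite (.natEq (.get 7 (rowIndex k)) (.const c))
      (setNat 3 (.add ((rowIndex k).times k) (.const c)) (.const 1))
      (setNat 3 (.add ((rowIndex k).times k) (.const c)) (.const 0)))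
    (s := s₁.writeNat 4 (slots k) r)
    (fun m s' => s'.nat 7 = s.nat 7 ∧ s'.nat 4 (slots k) = r ∧ (∀ i < r, ∀ c : Fin k,
      s'.nat 3 (i * k + c) = if s.nat 7 i = c then 1 else 0) ∧
      ∀ c : Fin k, (c : ℕ) < m → s'.nat 3 (r * k + c) = if s.nat 7 r = c then 1 else 0)
    ⟨by rw [← h1]; funext i; simp, by simp, by simpa using h2, by simp⟩ ?_
  · refine ⟨this.1, fun i hi c => ?_⟩
    rcases (Nat.lt_succ_iff.1 hi).lt_or_eq with h | h
    · exact this.2.2.1 i h c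
    · rw [h]; exact this.2.2.2 c c.2
  · rintro j s₂ ⟨g1, g2, g3, g4⟩
    have hexec : (ite (.natEq (.get 7 (rowIndex k)) (.const j))
        (setNat 3 (.add ((rowIndex k).times k) (.const j)) (.const 1))
        (setNat 3 (.add ((rowIndex k).times k) (.const j)) (.const 0))).exec s₂ =
        s₂.writeNat 3 (r * k + j) (if s.nat 7 r = j then 1 else 0) := by
      by_cases h : s.nat 7 r = j <;>
        simp [exec, Test.holds, NExpr.eval, rowIndex, g1, g2, h]
    simp only [hexec, State.writeNat_nat, true_and]
    refine ⟨by rw [← g1]; funext i; simp, by simpa using g2, fun i hi c => ?_, fun c hc => ?_⟩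
    · simp only [cell_inj c.2 j.2]
      rw [if_neg (by omega), g3 i hi c]
    · simp only [cell_inj c.2 j.2, true_and]
      by_cases h : (c : ℕ) = j
      · rw [if_pos h, h]
      · rw [if_neg h, g4 c (by omega)]

theorem writeInverse_spec (s : State) (Y : Matrix (Fin k) (Fin k) ℝ)
    (hY : ∀ i j : Fin k, s.real 3 (i * k + j) = Y i j) (hdet : s.real 4 0 = Y.det) (a b : Fin k) :
    ((writeInverse k).exec s).real 1 (a * k + b) = Y⁻¹ a b := by
  refine (unroll_induct (I := fun m s' => s'.real 3 = s.real 3 ∧ s'.real 4 = s.real 4 ∧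
    ∀ a : Fin k, (a : ℕ) < m → ∀ b : Fin k, s'.real 1 (a * k + b) = Y⁻¹ a b) (s := s)
    ⟨rfl, rfl, by simp⟩ ?_).2.2 a a.2 b
  rintro i s₁ ⟨h1, h2, h3⟩
  have := unroll_induct (p := fun b : Fin k => setReal 1 (.const (i * k + b))
      (.inv (fun i j : Fin k => .get 3 (.const (i * k + j))) (.get 4 (.const 0)) i b)) (s := s₁)
    (fun m s' => s'.real 3 = s.real 3 ∧ s'.real 4 = s.real 4 ∧
      (∀ a : Fin k, (a : ℕ) < i → ∀ b : Fin k, s'.real 1 (a * k + b) = Y⁻¹ a b) ∧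
      ∀ b : Fin k, (b : ℕ) < m → s'.real 1 (i * k + b) = Y⁻¹ i b)
    ⟨h1, h2, h3, by simp⟩ ?_
  · refine ⟨this.1, this.2.1, fun a ha b => ?_⟩
    rcases (Nat.lt_succ_iff.1 ha).lt_or_eq with h | h
    · exact this.2.2.1 a h b
    · rw [Fin.ext h]; exact this.2.2.2 b b.2
  · rintro j s₂ ⟨g1, g2, g3, g4⟩
    have hval := RExpr.eval_inv (s := s₂)
      (X := fun i j : Fin k => .get 3 (.const (i * k + j))) (e := .get 4 (.const 0)) (Y := Y)
      (fun a b => by rw [RExpr.eval, g1]; exact hY a b) (by rw [RExpr.eval, g2]; exact hdet) i j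
    simp only [exec, hval, State.writeReal_real, NExpr.eval, true_and]
    refine ⟨by rw [← g1]; funext i; simp, by rw [← g2]; funext i; simp, fun a ha b => ?_,
      fun b hb => ?_⟩
    · simp only [cell_inj b.2 j.2]
      rw [if_neg (by omega), g3 a ha b]
    · simp only [cell_inj b.2 j.2, true_and]
      split_ifs with h
      · rw [Fin.ext h]
      · exact g4 b (by omega)

end

end Code

/-! ### Correctness of the search and of the whole program. -/

namespace Code

section

variable {n d k : ℕ} {A : Matrix (Fin n) (Fin d) ℝ} {L : Fin k → Fin (d + 1)}

/-- The hypothesis `hk` guarantees that the default class exists whenever there is a row to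
classify. -/
theorem evaluate_spec (hk : 0 < k ∨ n = 0) {s : State} (hn : s.nat 0 0 = n)
    (hA : s.real 0 = (inputState A).real 0) :
    ∃ σ : Fin n → Fin k,
      (∀ τ : Fin n → Fin k, (∀ i : Fin n, Decides L (s.real 0) (s.real 2) (s.nat 4) i (τ i)) → σ = τ) ∧
      (∀ i : Fin n, ((evaluate L).exec s).nat 7 i = σ i) ∧
      (∀ a b : Fin k, ((evaluate L).exec s).real 3 (a * k + b) =
        ((onehot σ)ᵀ * picked A L) a b) ∧
      ((evaluate L).exec s).real 4 0 = ((onehot σ)ᵀ * picked A L).det := by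
  set s₁ := (clear k).exec s with hs₁
  have en : s₁.nat = s.nat := funext fun a => exec_nat (by simp [clear, KeepsNat]) _
  have er : ∀ a, a ≠ 3 → s₁.real a = s.real a := fun a ha =>
    exec_real (by simp [clear, KeepsReal, ha]) _
  obtain ⟨h1, h2⟩ := rows_spec (L := L) (n := n) s₁ (by rw [en, hn]) (clear_spec s)
  rw [er 0 (by decide), er 2 (by decide), en] at h1
  rw [er 0 (by decide)] at h2
  set s₂ := (count (slots k) 0 (rowStep L)).exec s₁ with hs₂
  let σ : Fin n → Fin k := fun i =>
    ⟨s₂.nat 7 i, (h1 i i.2).1 (hk.resolve_right fun h0 => (h0 ▸ i).elim0)⟩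
  have hX : ∀ a b : Fin k, s₂.real 3 (a * k + b) = ((onehot σ)ᵀ * picked A L) a b := by
    intro a b
    rw [h2, Finset.sum_range, mul_apply]
    refine Finset.sum_congr rfl fun i _ => ?_
    rw [transpose_apply, onehot_apply, hA, cellRow_inputState, ite_mul, one_mul, zero_mul]
    have : s₂.nat 7 i = a ↔ a = σ i := by rw [Fin.ext_iff]; exact eq_comm
    simp only [this]
  have he : (evaluate L).exec s = s₂.writeReal 4 0
      (RExpr.eval s₂ (.det fun i j : Fin k => .get 3 (.const (i * k + j)))) := rfl
  rw [he]
  refine ⟨σ, fun τ hτ => funext fun i => Fin.ext ((h1 i i.2).2 _ (hτ i)), fun i => rfl,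
    fun a b => ?_, ?_⟩
  · rw [← hX]
    simp
  · simp only [State.writeReal_real, and_self, if_true, RExpr.eval_det, RExpr.eval, NExpr.eval, hX]
    rfl

theorem accept_spec {s : State} (hn : s.nat 0 0 = n) {σ : Fin n → Fin k}
    {Y : Matrix (Fin k) (Fin k) ℝ} (hσ : ∀ i : Fin n, s.nat 7 i = σ i)
    (hY : ∀ a b : Fin k, s.real 3 (a * k + b) = Y a b) (hdet : s.real 4 0 = Y.det) :
    HasOutput ((accept L).exec s) k (onehot σ) L Y⁻¹ ∧ ((accept L).exec s).real 5 0 = Y.det := by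
  have kI : ∀ a, (writeInverse k).KeepsNat a := fun a => by simp [writeInverse, KeepsNat]
  have kA : ∀ a, a ≠ 3 → a ≠ 4 → (writeAssignment k).KeepsNat a := fun a h3 h4 => by
    simp [writeAssignment, KeepsNat, h3, h4]
  have kC : ∀ a, a ≠ 2 → (writeColumns L).KeepsNat a := fun a h => by
    simp [writeColumns, KeepsNat, h]
  have rI : ∀ a, a ≠ 1 → (writeInverse k).KeepsReal a := fun a h => by
    simp [writeInverse, KeepsReal, h]
  have rA : ∀ a, (writeAssignment k).KeepsReal a := fun a => by
    simp [writeAssignment, KeepsReal]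
  have rC : ∀ a, (writeColumns L).KeepsReal a := fun a => by simp [writeColumns, KeepsReal]
  simp only [accept, exec_seq]
  refine ⟨⟨?_, fun j => ?_, fun i c => ?_, fun a b => ?_⟩, ?_⟩
  · rw [exec_nat (kI 1), exec_nat (kA 1 (by decide) (by decide)), exec_nat (kC 1 (by decide))]
    simp [exec, NExpr.eval]
  · rw [exec_nat (kI 2), exec_nat (kA 2 (by decide) (by decide)), writeColumns_spec]
  · rw [exec_nat (kI 3), writeAssignment_spec _ _ i.2, exec_nat (kC 7 (by decide)), onehot_apply]
    · have : s.nat 7 i = c ↔ c = σ i := by rw [hσ, Fin.ext_iff]; exact eq_comm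
      simp [exec, this]
    · rw [exec_nat (kC 0 (by decide))]
      simpa [exec] using hn
  · refine writeInverse_spec _ Y (fun i j => ?_) ?_ a b
    · rw [exec_real (rA 3), exec_real (rC 3)]
      simpa [exec] using hY i j
    · rw [exec_real (rA 4), exec_real (rC 4)]
      simpa [exec] using hdet
  · rw [exec_real (rI 5 (by decide)), exec_real (rA 5), exec_real (rC 5)]
    simpa [exec, NExpr.eval, RExpr.eval] using hdet

/-- The two states agree on the arrays that hold the output. -/
def SameOutput (s s' : State) : Prop :=
  s.nat 1 = s'.nat 1 ∧ s.nat 2 = s'.nat 2 ∧ s.nat 3 = s'.nat 3 ∧ s.real 1 = s'.real 1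

theorem SameOutput.hasOutput {s s' : State} (h : SameOutput s s') {C : Matrix (Fin n) (Fin k) ℝ}
    {D : Matrix (Fin k) (Fin k) ℝ} (hs : HasOutput s' k C L D) : HasOutput s k C L D := by
  obtain ⟨h1, h2, h3, h4⟩ := h
  exact ⟨by rw [h1]; exact hs.rank, by rw [h2]; exact hs.columns, by rw [h3]; exact hs.assignment,
    by rw [h4]; exact hs.inverse⟩

theorem candidate_spec (hk : 0 < k ∨ n = 0) {s : State} (hn : s.nat 0 0 = n)
    (hA : s.real 0 = (inputState A).real 0) :
    ∃ σ : Fin n → Fin k,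
      (∀ τ : Fin n → Fin k, (∀ i : Fin n, Decides L (s.real 0) (s.real 2) (s.nat 4) i (τ i)) → σ = τ) ∧
      ((SameOutput ((candidate L).exec s) s ∧ ((candidate L).exec s).real 5 0 = s.real 5 0 ∧
          (((onehot σ)ᵀ * picked A L).det = 0 ∨
            s.real 5 0 ≠ 0 ∧ ((onehot σ)ᵀ * picked A L).det ≤ s.real 5 0)) ∨
        (HasOutput ((candidate L).exec s) k (onehot σ) L ((onehot σ)ᵀ * picked A L)⁻¹ ∧
          ((candidate L).exec s).real 5 0 = ((onehot σ)ᵀ * picked A L).det ∧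
          ((onehot σ)ᵀ * picked A L).det ≠ 0 ∧
          (s.real 5 0 = 0 ∨ s.real 5 0 < ((onehot σ)ᵀ * picked A L).det))) := by
  obtain ⟨σ, h1, h2, h3, h4⟩ := evaluate_spec (L := L) hk hn hA
  refine ⟨σ, h1, ?_⟩
  rw [candidate, exec_seq]
  have kn : ∀ a, a ≠ 3 → a ≠ 4 → a ≠ 2 → ((evaluate L).exec s).real a = s.real a :=
    fun a h h' h'' => exec_real (by
      simp [evaluate, clear, rowStep, KeepsReal, classify_keepsReal, accumulate, h, h']) s
  have kn' : ∀ a, a ≠ 4 → a ≠ 5 → a ≠ 6 → a ≠ 7 → ((evaluate L).exec s).nat a = s.nat a :=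
    fun a h h' h'' h''' => exec_nat (by
      simp [evaluate, clear, rowStep, KeepsNat, classify_keepsNat, accumulate, h, h', h'', h''']) s
  have hsame : SameOutput ((evaluate L).exec s) s :=
    ⟨kn' 1 (by decide) (by decide) (by decide) (by decide),
      kn' 2 (by decide) (by decide) (by decide) (by decide),
      kn' 3 (by decide) (by decide) (by decide) (by decide),
      kn 1 (by decide) (by decide) (by decide)⟩
  have h5 := kn 5 (by decide) (by decide) (by decide)
  have h0 : ((evaluate L).exec s).nat 0 0 = n := by
    rw [kn' 0 (by decide) (by decide) (by decide) (by decide), hn]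
  set s₁ := (evaluate L).exec s
  have hacc := accept_spec (L := L) h0 h2 h3 h4
  by_cases hd : ((onehot σ)ᵀ * picked A L).det = 0
  · rw [exec_ite_pos (by simpa [Test.holds, RExpr.eval, NExpr.eval, h4] using hd)]
    exact Or.inl ⟨hsame, by rw [exec, h5], Or.inl hd⟩
  rw [exec_ite_neg (by simpa [Test.holds, RExpr.eval, NExpr.eval, h4] using hd)]
  by_cases hb : s.real 5 0 = 0
  · rw [exec_ite_pos (by simpa [Test.holds, RExpr.eval, NExpr.eval, h5] using hb)]
    exact Or.inr ⟨hacc.1, hacc.2, hd, Or.inl hb⟩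
  rw [exec_ite_neg (by simpa [Test.holds, RExpr.eval, NExpr.eval, h5] using hb)]
  by_cases hlt : s.real 5 0 < ((onehot σ)ᵀ * picked A L).det
  · rw [exec_ite_pos (by simpa [Test.holds, RExpr.eval, NExpr.eval, h4, h5] using hlt)]
    exact Or.inr ⟨hacc.1, hacc.2, hd, Or.inr hlt⟩
  · rw [exec_ite_neg (by simpa [Test.holds, RExpr.eval, NExpr.eval, h4, h5] using hlt)]
    exact Or.inl ⟨hsame, by rw [exec, h5], Or.inr ⟨hb, not_lt.1 hlt⟩⟩

/-- The state holds a correct result for the data `A`. -/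
def Solved (A : Matrix (Fin n) (Fin d) ℝ) (s : State) : Prop :=
  ∃ (k : ℕ) (C : Matrix (Fin n) (Fin k) ℝ) (L : Fin k → Fin (d + 1))
    (D : Matrix (Fin k) (Fin k) ℝ), HasOutput s k C L D ∧ IsDMIClustering A k C L D

/-- The invariant of the search: cell `0` of array `5` holds the best determinant so far, or `0`
if there has been no nonzero one. -/
def SearchInv (A : Matrix (Fin n) (Fin d) ℝ) (L : Fin k → Fin (d + 1)) (s₀ s : State) : Prop :=
  s.nat 0 0 = n ∧ s.real 0 = (inputState A).real 0 ∧ (s.real 2 0 = 1 ∧ s.real 2 1 = -1) ∧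
    (s.real 5 0 = 0 ∧ SameOutput s s₀ ∨
      s.real 5 0 ≠ 0 ∧ ∃ σ : Fin n → Fin k,
        HasOutput s k (onehot σ) L ((onehot σ)ᵀ * picked A L)⁻¹ ∧
          s.real 5 0 = ((onehot σ)ᵀ * picked A L).det)

theorem SearchInv.candidate (hk : 0 < k ∨ n = 0) {s₀ s : State} (h : SearchInv A L s₀ s) :
    SearchInv A L s₀ ((candidate L).exec s) := by
  obtain ⟨hn, hA, h2, h5⟩ := h
  have k2 : ((Code.candidate L).exec s).real 2 = s.real 2 := exec_real (by
    simp [Code.candidate, evaluate, accept, clear, writeColumns, writeAssignment, writeInverse,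
      rowStep, KeepsReal, classify_keepsReal, accumulate]) s
  refine ⟨by rw [exec_nat candidate_wf.keepsNat, hn],
    by rw [exec_real candidate_wf.keepsReal, hA], by rw [k2]; exact h2, ?_⟩
  obtain ⟨σ, -, ⟨c1, c2, -⟩ | ⟨c1, c2, c3, -⟩⟩ := candidate_spec (L := L) hk hn hA
  · rw [c2]
    rcases h5 with ⟨g1, g2⟩ | ⟨g1, τ, g2, g3⟩
    · exact Or.inl ⟨g1, c1.1.trans g2.1, c1.2.1.trans g2.2.1, c1.2.2.1.trans g2.2.2.1,
        c1.2.2.2.trans g2.2.2.2⟩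
    · exact Or.inr ⟨g1, τ, c1.hasOutput g2, g3⟩
  · exact Or.inr ⟨by rw [c2]; exact c3, σ, c1, c2⟩

theorem SearchInv.writeNat {s₀ s : State} (h : SearchInv A L s₀ s) (v r : ℕ) :
    SearchInv A L s₀ (s.writeNat 4 v r) := by
  obtain ⟨hn, hA, h2, h5⟩ := h
  have hsame : SameOutput (s.writeNat 4 v r) s :=
    ⟨funext fun i => by simp, funext fun i => by simp, funext fun i => by simp, rfl⟩
  refine ⟨by simpa using hn, hA, h2, ?_⟩
  rcases h5 with ⟨g1, g2⟩ | ⟨g1, τ, g2, g3⟩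
  · exact Or.inl ⟨g1, hsame.1.trans g2.1, hsame.2.1.trans g2.2.1, hsame.2.2.1.trans g2.2.2.1,
      hsame.2.2.2.trans g2.2.2.2⟩
  · exact Or.inr ⟨g1, τ, hsame.hasOutput g2, g3⟩

/-- Every choice of rows and signs for the scores is described by some candidate. -/
theorem exists_candidate (A : Matrix (Fin n) (Fin d) ℝ) (L : Fin k → Fin (d + 1))
    (f : Fin k → Fin k → Fin k → Fin k → Fin n) (t : Fin k → Fin k → Fin k → ℝ)
    (ht : ∀ c c' j, t c c' j = 1 ∨ t c c' j = -1) :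
    ∃ x : ℕ → ℕ, (∀ v, x v < n + 2) ∧ ∀ (g : ℕ → ℝ), (g 0 = 1 ∧ g 1 = -1) →
      ∀ (i : Fin n) (c c' : Fin k), candidateScore L ((inputState A).real 0) g x i c c' =
        score (fun j l => picked A L (f c c' j l)) (t c c') (picked A L i) := by
  classical
  let e := Fintype.equivFin (Fin k × Fin k × Fin k × Fin k)
  -- The last slot holds the cell of the sign, the others hold rows. The bound n + 2 leaves room for
  -- the sign cells 0 and 1 even when n = 0.
  let y : Fin k × Fin k × Fin k × Fin k → ℕ := fun q =>
    if (q.2.2.2 : ℕ) + 1 = k then (if t q.1 q.2.1 q.2.2.1 = 1 then 0 else 1)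
    else f q.1 q.2.1 q.2.2.1 q.2.2.2
  have hy : ∀ q, y q < n + 2 := by
    intro q
    simp only [y]
    split_ifs
    · omega
    · omega
    · have := (f q.1 q.2.1 q.2.2.1 q.2.2.2).2; omega
  let x : ℕ → ℕ := fun v => if h : v < slots k then y (e.symm ⟨v, h⟩) else 0
  have hx : ∀ c c' j l, x (slot c c' j l) = y (c, c', j, l) := by
    intro c c' j l
    simp only [x]
    rw [dif_pos (slot_lt c c' j l)]
    congr 1
    exact e.symm_apply_apply _
  refine ⟨x, fun v => ?_, fun g hg i c c' => ?_⟩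
  · simp only [x]
    split_ifs
    · exact hy _
    · omega
  · simp only [candidateScore, score, hx, cellRow_inputState]
    refine Finset.sum_congr rfl fun j _ => ?_
    have hlast : ((lastSlot j : Fin k) : ℕ) + 1 = k := by
      have := j.2; simp only [lastSlot]; omega
    congr 1
    · simp only [y, hlast, if_true]
      rcases ht c c' j with h | h
      · simp [h, hg.1]
      · rw [h, if_neg (by norm_num), hg.2]
    · congr 1
      ext l r
      by_cases hl : (l : ℕ) + 1 = k
      · simp [hl]
      · simp only [of_apply, y, hl, if_false, cellRow_inputState]

/-- The invariant says that a nonzero recorded value is the determinant of an actual assignment. For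
dependent columns this is impossible, so nothing is ever output; for a column choice, visiting the
candidate of a maximizer makes the recorded value maximal. -/
theorem search_spec (hk : 0 < k ∨ n = 0) {s : State} (hn : s.nat 0 0 = n)
    (hA : s.real 0 = (inputState A).real 0) :
    (¬ LinearIndependent ℝ (picked A L).col → SameOutput ((search L).exec s) s) ∧
      (IsColumnChoice A L → Solved A ((search L).exec s)) := by
  rw [search, exec_seq, exec_seq, exec_seq]
  set s₁ := (setReal 2 (.const 1) (.const (-1))).exec ((setReal 2 (.const 0) (.const 1)).exec
    ((setReal 5 (.const 0) (.const 0)).exec s)) with hs₁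
  have h1 : SearchInv A L s s₁ := by
    refine ⟨hn, by rw [← hA]; funext i; simp [hs₁, exec], ?_,
      Or.inl ⟨?_, rfl, rfl, rfl, funext fun i => by simp [hs₁, exec]⟩⟩ <;>
    simp [hs₁, exec, NExpr.eval, RExpr.eval]
  constructor
  · intro hdep
    have h2 := (nest_spec (p := candidate L) (n := n) (M := slots k) candidate_wf
      (fun v hv => candidate_uses hv) (fun _ => 0) (fun _ => by omega) (SearchInv A L s)
      (fun _ => True) (fun s hs => hs.1) (fun s v r hs => hs.writeNat v r) (fun _ _ _ _ => trivial)
      (fun s hs => hs.candidate hk) (fun _ _ _ => trivial) (fun _ _ _ => trivial) le_rfl s₁ h1).1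
    rcases h2.2.2.2 with h | ⟨h3, σ, -, h5⟩
    · exact h.2
    · exact absurd (linearIndependent_of_det_ne_zero (h5 ▸ h3)) hdep
  · intro hL
    obtain ⟨b, hb⟩ := hL.exists_mulVec_eq_one
    obtain ⟨τ, f, t, hdet, hmax, ht, hsc⟩ := exists_score_maximizer hL.2 hb
    obtain ⟨x, hx, hxs⟩ := exists_candidate A L f t ht
    have hdec : ∀ s', SearchInv A L s s' → (∀ v < slots k, s'.nat 4 v = x v) → ∀ i : Fin n,
        Decides L (s'.real 0) (s'.real 2) (s'.nat 4) i (τ i) := by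
      intro s' hs' hv i c hne
      rw [candidateScore_congr L hv, candidateScore_congr L hv, hs'.2.1,
        hxs _ hs'.2.2.1, hxs _ hs'.2.2.1]
      exact ⟨(hsc i (τ i) c hne).1 rfl, (hsc i c (τ i) hne.symm).2 rfl⟩
    obtain ⟨h2, -, h3⟩ := nest_spec (p := candidate L) (n := n) (M := slots k) candidate_wf
      (fun v hv => candidate_uses hv) x hx (SearchInv A L s)
      -- The recorded value only increases once it is nonzero, so this property is never lost.
      (fun s' => s'.real 5 0 ≠ 0 ∧ ((onehot τ)ᵀ * picked A L).det ≤ s'.real 5 0)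
      (fun s hs => hs.1) (fun s v r hs => hs.writeNat v r) (fun _ _ _ h => h)
      (fun s hs => hs.candidate hk)
      (fun s' hs' hQ => by
        obtain ⟨σ, -, ⟨-, c2, -⟩ | ⟨-, c2, c3, c4⟩⟩ := candidate_spec (L := L) hk hs'.1 hs'.2.1
        · rw [c2]; exact hQ
        · rw [c2]; exact ⟨c3, hQ.2.trans (c4.resolve_left hQ.1).le⟩)
      (fun s' hs' hv => by
        obtain ⟨σ, c1, hc⟩ := candidate_spec (L := L) hk hs'.1 hs'.2.1
        obtain rfl := c1 τ (hdec s' hs' hv)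
        rcases hc with ⟨-, c2, c3⟩ | ⟨-, c2, c3, -⟩
        · rw [c2]; exact c3.resolve_left hdet
        · rw [c2]; exact ⟨c3, le_rfl⟩)
      le_rfl s₁ h1
    obtain ⟨h4, h5⟩ := h3 fun v hv hv' => absurd hv (not_lt.2 hv')
    rcases h2.2.2.2 with h | ⟨-, σ, h6, h7⟩
    · exact absurd h.1 h4
    · rw [h7] at h4 h5
      refine ⟨k, onehot σ, L, _, h6, hL, onehot_mem σ, fun C' hC' => ?_,
        isUnit_iff_ne_zero.2 h4, rfl⟩
      obtain ⟨ρ, rfl⟩ := exists_onehot_eq hC'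
      exact (hmax ρ).trans h5

theorem Solved.of_sameOutput {s s' : State} (h : SameOutput s s') (hs : Solved A s') :
    Solved A s := by
  obtain ⟨k, C, L, D, h1, h2⟩ := hs
  exact ⟨k, C, L, D, h.hasOutput h1, h2⟩

/-- Searches with fewer columns than the rank may leave any output. At the rank, each independent
list installs a correct result and dependent lists change nothing; longer lists are dependent and
preserve it. -/
theorem solve_spec (A : Matrix (Fin n) (Fin d) ℝ) :
    Solved A ((solve d).exec (inputState A)) := by
  have hrank : (augment A).rank < d + 2 := by
    have := (augment A).rank_le_width
    omega
  -- The column of ones makes the rank positive when there are data points. Searches with k = 0 < n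
  -- thus occur only below the rank, where nothing is claimed.
  have hpos : ∀ k : ℕ, (augment A).rank ≤ k → 0 < k ∨ n = 0 := by
    intro k hk
    rcases Nat.eq_zero_or_pos n with hn | hn
    · exact Or.inr hn
    · refine Or.inl (lt_of_lt_of_le ?_ hk)
      refine Nat.pos_of_ne_zero fun h0 => ?_
      rw [rank_eq_finrank_span_cols, Submodule.finrank_eq_zero, Submodule.span_eq_bot] at h0
      have h1 := congrFun (h0 _ ⟨Fin.last d, rfl⟩) ⟨0, hn⟩
      exact one_ne_zero ((augment_last A ⟨0, hn⟩).symm.trans h1)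
  refine (unroll_induct (p := fun k : Fin (d + 2) =>
    each (Finset.univ : Finset (Fin k → Fin (d + 1))).toList fun L => search L)
    (fun m s => s.nat 0 0 = n ∧ s.real 0 = (inputState A).real 0 ∧
      ((augment A).rank < m → Solved A s)) ⟨by simp [inputState], rfl, by simp⟩ ?_).2.2 hrank
  rintro k s ⟨h1, h2, h3⟩
  have := each_induct (l := (Finset.univ : Finset (Fin k → Fin (d + 1))).toList)
    (p := fun L => search L) (s := s)
    (fun l s => s.nat 0 0 = n ∧ s.real 0 = (inputState A).real 0 ∧
      ((augment A).rank < k → Solved A s) ∧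
      ((augment A).rank = k → Solved A s ∨ ∃ L ∈ l, IsColumnChoice A L))
    ⟨h1, h2, h3, fun hk => Or.inr ?_⟩ ?_
  · refine ⟨this.1, this.2.1, fun hlt => ?_⟩
    rcases (Nat.lt_succ_iff.1 hlt).lt_or_eq with h | h
    · exact this.2.2.1 h
    · exact (this.2.2.2 h).resolve_right (by simp)
  · generalize (k : ℕ) = k' at hk
    subst hk
    obtain ⟨L, hL⟩ := exists_isColumnChoice (A := A)
    exact ⟨L, by simp, hL⟩
  · rintro L l s ⟨g1, g2, g3, g4⟩
    have hkeep : ¬ LinearIndependent ℝ (picked A L).col → (augment A).rank ≤ k →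
        SameOutput ((search L).exec s) s := fun h hk =>
      (search_spec (hpos k hk) g1 g2).1 h
    refine ⟨by rw [exec_nat search_wf.keepsNat, g1], by rw [exec_real search_wf.keepsReal, g2],
      fun hlt => ?_, fun heq => ?_⟩
    · refine (g3 hlt).of_sameOutput (hkeep (fun h => ?_) hlt.le)
      exact absurd (le_rank_of_linearIndependent h) (not_le.2 hlt)
    · by_cases hL : LinearIndependent ℝ (picked A L).col
      · exact Or.inl ((search_spec (hpos k heq.le) g1 g2).2 ⟨heq.symm, hL⟩)
      · refine (g4 heq).imp (fun h => h.of_sameOutput (hkeep hL heq.le)) ?_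
        rintro ⟨L', hL', hc⟩
        rcases List.mem_cons.1 hL' with rfl | hmem
        · exact absurd hc.2 hL
        · exact ⟨L', hmem, hc⟩

end

end Code

theorem exists_solvesDMI (d : ℕ) :
    ∃ (p : Program) (T : Polynomial ℕ), SolvesDMI d p fun n => T.eval n := by
  refine ⟨(Code.solve d).compile, (Code.solve d).time, fun n A => ?_⟩
  obtain ⟨t, ht, hle⟩ := Code.run_compile Code.solve_wf (inputState A)
  exact ⟨t, _, ht, by simpa [inputState] using hle, Code.solve_spec A⟩

/-! ## Counting linear partitions -/

/-! ### Sign vectors of linear forms on a subspace. -/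

section SignVectors

variable {E : Type} [AddCommGroup E] [Module ℝ E] (φ : ℕ → E →ₗ[ℝ] ℝ)

/-- The signs of the first `m` linear forms at `v`. -/
noncomputable def signVector (m : ℕ) (v : E) : Fin m → SignType := fun i => SignType.sign (φ i v)

theorem sign_add_mul_eq {a b x y : ℝ} (ha : 0 < a) (hb : 0 < b)
    (h : SignType.sign x = SignType.sign y) :
    SignType.sign (a * x + b * y) = SignType.sign x := by
  rcases lt_trichotomy x 0 with hx | hx | hx
  · have hy : y < 0 := by rw [← sign_eq_neg_one_iff, ← h, sign_eq_neg_one_iff]; exact hx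
    rw [sign_neg hx, sign_eq_neg_one_iff]
    nlinarith [mul_neg_of_pos_of_neg ha hx, mul_neg_of_pos_of_neg hb hy]
  · have hy : y = 0 := by rw [← sign_eq_zero_iff, ← h, hx, sign_zero]
    rw [hx, hy]; simp
  · have hy : 0 < y := by rw [← sign_eq_one_iff, ← h, sign_eq_one_iff]; exact hx
    rw [sign_pos hx, sign_eq_one_iff]
    positivity

/-- Induction on m. Split the patterns of the first m forms into T 0, T 1 and T (-1) by the sign of
the new form. Patterns in T 0, and those common to T 1 and T (-1), already occur on its kernel W,
whose dimension is smaller unless the form vanishes on V. -/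
theorem ncard_signVector_le [FiniteDimensional ℝ E] (m : ℕ) (V : Submodule ℝ E) :
    (signVector φ m '' (V : Set E)).ncard ≤ (2 * m + 1) ^ Module.finrank ℝ V := by
  induction m generalizing V with
  | zero =>
    simp only [mul_zero, zero_add, one_pow]
    exact Set.ncard_le_one_of_subsingleton _
  | succ m ih =>
    let T : SignType → Set (Fin m → SignType) := fun ε =>
      signVector φ m '' {v | v ∈ V ∧ SignType.sign (φ m v) = ε}
    let W := V ⊓ LinearMap.ker (φ m)
    have hT : ∀ ε, T ε ⊆ signVector φ m '' (V : Set E) := fun ε =>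
      Set.image_mono fun v hv => hv.1
    have hT0 : T 0 ⊆ signVector φ m '' (W : Set E) :=
      Set.image_mono fun v hv => ⟨hv.1, sign_eq_zero_iff.1 hv.2⟩
    have hinter : T 1 ∩ T (-1) ⊆ signVector φ m '' (W : Set E) := by
      rintro p ⟨⟨v, ⟨hv, hv1⟩, rfl⟩, w, ⟨hw, hw1⟩, hvw⟩
      rw [sign_eq_one_iff] at hv1
      rw [sign_eq_neg_one_iff] at hw1
      -- The point of the segment direction from v to w, up to positive scale, at which the new form
      -- vanishes; both coefficients are positive, so common signs persist.
      refine ⟨(-φ m w) • v + φ m v • w, ⟨V.add_mem (V.smul_mem _ hv) (V.smul_mem _ hw), ?_⟩, ?_⟩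
      · rw [SetLike.mem_coe, LinearMap.mem_ker, map_add, map_smul, map_smul, smul_eq_mul,
          smul_eq_mul]
        ring
      · funext i
        simp only [signVector, map_add, map_smul, smul_eq_mul]
        exact sign_add_mul_eq (neg_pos.2 hw1) hv1 (congrFun hvw i).symm
    have hsub : signVector φ (m + 1) '' (V : Set E) ⊆ ⋃ ε, (fun p =>
        Fin.snoc (α := fun _ => SignType) p ε) '' T ε := by
      rintro _ ⟨v, hv, rfl⟩
      refine Set.mem_iUnion.2 ⟨SignType.sign (φ m v), signVector φ m v, ⟨v, ⟨hv, rfl⟩, rfl⟩, ?_⟩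
      funext i
      refine Fin.lastCases ?_ (fun i => ?_) i <;> simp [signVector]
    have hcard : (signVector φ (m + 1) '' (V : Set E)).ncard ≤
        (T 0).ncard + (T 1).ncard + (T (-1)).ncard := by
      refine (Set.ncard_le_ncard hsub (Set.toFinite _)).trans ?_
      have : (⋃ ε, (fun p => Fin.snoc (α := fun _ => SignType) p ε) '' T ε) ⊆
          (fun p => Fin.snoc (α := fun _ => SignType) p 0) '' T 0 ∪
          (fun p => Fin.snoc (α := fun _ => SignType) p 1) '' T 1 ∪
          (fun p => Fin.snoc (α := fun _ => SignType) p (-1)) '' T (-1) := by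
        refine Set.iUnion_subset fun ε => ?_
        rcases ε with _ | _ | _
        · exact fun p hp => Or.inl (Or.inl hp)
        · exact fun p hp => Or.inr hp
        · exact fun p hp => Or.inl (Or.inr hp)
      refine (Set.ncard_le_ncard this (Set.toFinite _)).trans ?_
      refine (Set.ncard_union_le _ _).trans (add_le_add ((Set.ncard_union_le _ _).trans
        (add_le_add ?_ ?_)) ?_) <;> exact Set.ncard_image_le (Set.toFinite _)
    by_cases hV : V ≤ LinearMap.ker (φ m)
    · have hempty : ∀ ε, ε ≠ 0 → T ε = ∅ := by
        intro ε hε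
        refine Set.eq_empty_of_forall_notMem ?_
        rintro _ ⟨v, ⟨hv, hv'⟩, rfl⟩
        rw [LinearMap.mem_ker.1 (hV hv), sign_zero] at hv'
        exact hε hv'.symm
      rw [hempty 1 (by decide), hempty (-1) (by decide), Set.ncard_empty, add_zero, add_zero]
        at hcard
      calc _ ≤ (T 0).ncard := hcard
        _ ≤ _ := Set.ncard_le_ncard (hT 0) (Set.toFinite _)
        _ ≤ _ := ih V
        _ ≤ _ := Nat.pow_le_pow_left (by omega) _
    · have hlt : Module.finrank ℝ W < Module.finrank ℝ V :=
        Submodule.finrank_lt_finrank_of_lt (lt_of_le_of_ne inf_le_left fun h =>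
          hV (inf_eq_left.1 h))
      obtain ⟨e, he⟩ : ∃ e, Module.finrank ℝ V = e + 1 := ⟨Module.finrank ℝ V - 1, by omega⟩
      have h1 : (T 1 ∪ T (-1)).ncard ≤ (2 * m + 1) ^ (e + 1) := by
        rw [← he]
        exact (Set.ncard_le_ncard (Set.union_subset (hT 1) (hT (-1))) (Set.toFinite _)).trans (ih V)
      have hW : (signVector φ m '' (W : Set E)).ncard ≤ (2 * m + 1) ^ e :=
        (ih W).trans (Nat.pow_le_pow_right (by omega) (by omega))
      have h2 := (Set.ncard_le_ncard hinter (Set.toFinite _)).trans hW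
      have h3 := (Set.ncard_le_ncard hT0 (Set.toFinite _)).trans hW
      have h4 := Set.ncard_union_add_ncard_inter (T 1) (T (-1)) (Set.toFinite _) (Set.toFinite _)
      rw [he]
      -- The sizes of T 1 and T (-1) add up to union plus intersection: the union is bounded on V,
      -- the intersection and T 0 on W.
      calc _ ≤ (2 * m + 1) ^ e + ((2 * m + 1) ^ (e + 1) + (2 * m + 1) ^ e) := by omega
        _ = (2 * m + 1) ^ e * (2 * (m + 1) + 1) := by ring
        _ ≤ (2 * (m + 1) + 1) ^ e * (2 * (m + 1) + 1) :=
          Nat.mul_le_mul_right _ (Nat.pow_le_pow_left (by omega) _)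
        _ = _ := by ring

end SignVectors

/-! ### From sign vectors to linear partitions. -/

section Partitions

variable {n k : ℕ} (M : Matrix (Fin n) (Fin k) ℝ)

/-- The comparison of the classes `c` and `c'` at row `i`, as a function of `D`. -/
def comparison (i : Fin n) (c c' : Fin k) : Matrix (Fin k) (Fin k) ℝ →ₗ[ℝ] ℝ where
  toFun D := (M * D) i c - (M * D) i c'
  map_add' D D' := by simp only [Matrix.mul_add, Matrix.add_apply]; ring
  map_smul' r D := by
    simp only [Matrix.mul_smul, Matrix.smul_apply, smul_eq_mul, RingHom.id_apply]; ring

/-- The set `idxmax (M * D)` is a function of the signs of all `comparison M i c c' D`, which are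
linear in D. -/
theorem encard_linearPartitions_le :
    (linearPartitions M).encard ≤ ((2 * (n * k * k) + 1) ^ (k * k) : ℕ) := by
  let e := Fintype.equivFinOfCardEq (α := Fin n × Fin k × Fin k) (n := n * k * k)
    (by simp [Nat.mul_assoc])
  let φ : ℕ → Matrix (Fin k) (Fin k) ℝ →ₗ[ℝ] ℝ := fun v =>
    if h : v < n * k * k then comparison M (e.symm ⟨v, h⟩).1 (e.symm ⟨v, h⟩).2.1
      (e.symm ⟨v, h⟩).2.2 else 0
  have hφ : ∀ i c c' D, signVector φ (n * k * k) D (e (i, c, c')) =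
      SignType.sign (comparison M i c c' D) := by
    intro i c c' D
    simp only [signVector, φ, Fin.is_lt, dif_pos, Fin.eta, Equiv.symm_apply_apply]
  let G : (Fin (n * k * k) → SignType) → Set (Matrix (Fin n) (Fin k) ℝ) := fun p =>
    {C | C ∈ hardConstraint n k ∧ ∀ i c, C i c = 1 → ∀ c', 0 ≤ p (e (i, c, c'))}
  have hG : ∀ D, idxmax (M * D) = G (signVector φ (n * k * k) D) := by
    intro D
    ext C
    simp only [idxmax, G, Set.mem_ofPred_eq, hφ, sign_nonneg_iff, comparison, LinearMap.coe_mk,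
      AddHom.coe_mk, sub_nonneg]
  have hrange : linearPartitions M =
      G '' (signVector φ (n * k * k) '' ((⊤ : Submodule ℝ (Matrix (Fin k) (Fin k) ℝ)) : Set _)) := by
    rw [Submodule.top_coe, Set.image_univ, ← Set.range_comp]
    exact congrArg Set.range (funext hG)
  rw [hrange]
  refine (Set.encard_image_le _ _).trans ?_
  rw [← (Set.toFinite _).cast_ncard_eq, Nat.cast_le]
  refine (ncard_signVector_le φ (n * k * k) ⊤).trans_eq ?_
  rw [finrank_top, Module.finrank_matrix]
  simp

/-- With at most one class there is nothing to compare. This case is separate because the exponent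
k(k-1)(k+1) is then zero. -/
theorem encard_linearPartitions_le_one (hk : k ≤ 1) : (linearPartitions M).encard ≤ 1 := by
  rw [Set.encard_le_one_iff]
  have : Subsingleton (Fin k) := Fin.subsingleton_iff_le_one.2 hk
  have h : ∀ N : Matrix (Fin n) (Fin k) ℝ, idxmax N = hardConstraint n k := fun N =>
    Set.ext fun C => ⟨fun h => h.1, fun h => ⟨h, fun i c _ c' => by
      rw [Subsingleton.elim c' c]⟩⟩
  rintro _ _ ⟨D, rfl⟩ ⟨D', rfl⟩
  simp only [h]

end Partitions

/-- For k ≥ 2 the exponent k * k is at most k(k-1)(k+1), and n is positive because k is the rank. -/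
theorem encard_linearPartitions_picked_le {n d k : ℕ} {A : Matrix (Fin n) (Fin d) ℝ}
    {L : Fin k → Fin (d + 1)} (h : IsColumnChoice A L) :
    (linearPartitions (picked A L)).encard ≤
      (((3 * (d + 1) ^ 2) ^ ((d + 1) ^ 2) * n ^ (k * (k - 1) * (k + 1)) : ℕ) : ℕ∞) := by
  rcases Nat.lt_or_ge 1 k with hk | hk
  · have hkd : k ≤ d + 1 := h.1.trans_le (augment A).rank_le_width
    have hkn : k ≤ n := h.1.trans_le (augment A).rank_le_height
    refine (encard_linearPartitions_le _).trans (Nat.cast_le.2 ?_)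
    have h1 : k * k ≤ k * (k - 1) * (k + 1) := by
      obtain ⟨j, rfl⟩ : ∃ j, k = j + 2 := ⟨k - 2, by omega⟩
      rw [mul_assoc]
      exact Nat.mul_le_mul_left _ (by simp; nlinarith)
    have h2 : k * k ≤ (d + 1) ^ 2 := by rw [sq]; exact Nat.mul_le_mul hkd hkd
    have h3 : 1 ≤ n * k * k := Nat.mul_pos (Nat.mul_pos (by omega) (by omega)) (by omega)
    -- Since n * k * k ≥ 1, the summand 1 is absorbed into a factor 3, and k ≤ d + 1 removes the
    -- dependence on k from the constant.
    calc (2 * (n * k * k) + 1) ^ (k * k) ≤ (3 * (d + 1) ^ 2 * n) ^ (k * k) :=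
          Nat.pow_le_pow_left (by nlinarith) _
      _ = (3 * (d + 1) ^ 2) ^ (k * k) * n ^ (k * k) := mul_pow _ _ _
      _ ≤ _ := Nat.mul_le_mul (Nat.pow_le_pow_right (by positivity) h2)
          (Nat.pow_le_pow_right (by omega) h1)
  · refine (encard_linearPartitions_le_one _ hk).trans ?_
    have : k * (k - 1) = 0 := by
      rcases Nat.le_one_iff_eq_zero_or_eq_one.1 hk with rfl | rfl <;> rfl
    rw [this, zero_mul, pow_zero, mul_one]
    exact_mod_cast Nat.one_le_pow _ _ (by positivity)

end DMI

theorem mainTheorem3 (d : ℕ) :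
    (∃ (p : DMI.Program) (T : Polynomial ℕ), DMI.SolvesDMI d p (fun n => T.eval n)) ∧
      ∃ K : ℕ, ∀ (n k : ℕ) (A : Matrix (Fin n) (Fin d) ℝ) (L : Fin k → Fin (d + 1)),
        DMI.IsColumnChoice A L →
          (DMI.linearPartitions (DMI.picked A L)).encard
            ≤ ((K * n ^ (k * (k - 1) * (k + 1)) : ℕ) : ℕ∞) :=
  ⟨DMI.exists_solvesDMI d, _, fun _ _ _ _ h => DMI.encard_linearPartitions_picked_le h⟩
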